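/- **Setting (linear bandits with stochastic contexts).** Let $d,K\ge 1$, $T\ge 3$, $\delta\in(0,1)$; $\log=\log_2$, $\ln=\log_e$. A vector $\theta\in\mathbb R^d$ with $\|\theta\|\le 1$ is hidden. At each time $t=1,\dots,T$ the context vectors $X_t=(x_{t1},\dots,x_{tK})\in(\mathbb R^d)^K$ are drawn independently from a distribution $\mathcal D$, unknown to the learner, with $\|x_{ti}\|\le1$ almost surely (the $K$ vectors of one time step may be dependent). The learner observes $X_t$, draws an arm $i_t$ from its current randomized policy, and gets the reward $r_t=\theta^\top x_{t,i_t}+\varepsilon_t$, where the noises $\varepsilon_t$ are sub-Gaussian with variance proxy at most $1$, independent of each other, of the contexts and of the learner's randomization. A batch learner fixes a grid $0=\mathcal T_0<\mathcal T_1<\dots<\mathcal T_M=T$; within batch $k$ (times $\mathcal T_{k-1}<t\le\mathcal T_k$) it uses one policy, which depends only on the observations of earlier batches; $M$ is the number of batches. The regret is $\mathrm{Reg}=\sum_{t=1}^T\big(\max_{i\in[K]} x_{ti}^\top\theta-x_{t,i_t}^\top\theta\big)$, and the $(1-\delta)$-high probability expected regret is $\sup_A\mathbb E[\mathbf 1_A\,\mathrm{Reg}]$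 over all events $A$ with $\Pr[A]\ge1-\delta$. **G-optimal design.** $\pi^{\mathsf G}$ is any measurable rule which assigns to a finite nonempty family $X$ of vectors a distribution supported on $X$ such that, for every $\varepsilon>0$, $\max_{x\in X}x^\top\big(\varepsilon I+\mathbb E_{y\sim\pi^{\mathsf G}(X)}yy^\top\big)^{-1}x\le 2d$. **Algorithm BatchLinUCB-KW.** Put $M=\lceil\log\log T\rceil$, $\alpha=10\sqrt{\ln(2dKT/\delta)}$, $\lambda=16\ln(2dT/\delta)$, $\mathcal T_0=0$, $\mathcal T_i=\lfloor T^{1-2^{-i}}\rfloor$ for $1\le i<M$, $\mathcal T_M=T$. In batch $k$, at each time $t$: start with $A_t^{(0)}=[K]$; for $\kappa=1,\dots,k-1$ put $\hat r_{ti}^{(\kappa)}=x_{ti}^\top\hat\theta_\kappa$, $\omega_{ti}^{(\kappa)}=\alpha\sqrt{x_{ti}^\top\Lambda_\kappa^{-1}x_{ti}}$ and $$A_t^{(\kappa)}=\{i\in A_t^{(\kappa-1)}:\ \hat r_{ti}^{(\kappa)}+\omega_{ti}^{(\kappa)}\ge\hat r_{tj}^{(\kappa)}-\omega_{tj}^{(\kappa)}\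 \ \forall j\in A_t^{(\kappa-1)}\};$$ play $i_t$ with $x_{t,i_t}\sim\pi^{\mathsf G}(\{x_{ti}:i\in A_t^{(k-1)}\})$. At the end of batch $k$ set $\Lambda_k=\lambda I+\sum_{t\text{ in batch }k}x_{t,i_t}x_{t,i_t}^\top$ and $\hat\theta_k=\Lambda_k^{-1}\sum_{t\text{ in batch }k}r_tx_{t,i_t}$. **Theorem.** There is an absolute constant $C>0$ such that for all $d,K\ge1$, $T\ge3$, $\delta\in(0,1)$: rules $\pi^{\mathsf G}$ as above exist, and for each of them BatchLinUCB-KW is a batch learner with $M\le C\log\log T$ batches (with $0=\mathcal T_0<\mathcal T_1<\dots<\mathcal T_M=T$), and for every $\mathcal D$, $\theta$ and noise as above the regret is integrable and its $(1-\delta)$-high probability expected regret is at most $$C\,d\,\sqrt{T\log(dKT/\delta)}\;\log\log T .$$ -/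

import Mathlib

open MeasureTheory ProbabilityTheory
open scoped NNReal

noncomputable section

namespace BatchLinBandit

/-- The context vectors of the `K` arms at one time step. -/
abbrev Ctx (d K : ℕ) : Type := Fin K → EuclideanSpace ℝ (Fin d)

/-- What the learner records at one time step: context vectors, played arm, received reward. -/
abbrev Obs (d K : ℕ) : Type := Ctx d K × Fin K × ℝ

/-- The context vector of the arm that was played. -/
def Obs.played {d K : ℕ} (o : Obs d K) : EuclideanSpace ℝ (Fin d) := o.1 o.2.1

/-- The reward that was received. -/
def Obs.reward {d K : ℕ} (o : Obs d K) : ℝ := o.2.2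

/-- The rank-one matrix `x xᵀ`. -/
def outer {d : ℕ} (x : EuclideanSpace ℝ (Fin d)) : Matrix (Fin d) (Fin d) ℝ :=
  Matrix.vecMulVec x.ofLp x.ofLp

/-- The quadratic form `xᵀ Λ⁻¹ x`. -/
def invQuad {d : ℕ} (Λ : Matrix (Fin d) (Fin d) ℝ) (x : EuclideanSpace ℝ (Fin d)) : ℝ :=
  x.ofLp ⬝ᵥ Matrix.mulVec Λ⁻¹ x.ofLp

/-! ### The batch learning model

Time steps are `0, …, T - 1`, batches are numbered from `0`; batch `k` consists of the time steps
`t` with `grid k ≤ t < grid (k + 1)`. -/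

/-- A batch learner: a static grid, and for each batch a policy, which maps context vectors to the
probabilities of the arms and which is determined by what was observed in the earlier batches. -/
structure BatchLearner (d K T : ℕ) where
  /-- number of batches -/
  numBatches : ℕ
  /-- end points of the batches -/
  grid : ℕ → ℕ
  /-- policy of batch `k`, given the observations made before time `grid k` -/
  policy : (k : ℕ) → ({t : Fin T // (t : ℕ) < grid k} → Obs d K) → Ctx d K → Fin K → ℝ

/-- The grid is `0 = grid 0 < grid 1 < ⋯ < grid M = T`, with `M` the number of batches. -/
def BatchLearner.IsGrid {d K T : ℕ} (L : BatchLearner d K T) : Prop :=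
  L.grid 0 = 0 ∧ L.grid L.numBatches = T ∧ StrictMonoOn L.grid (Set.Iic L.numBatches)

open Classical in
/-- Inverse-CDF sampling: for `u` uniform on `[0, 1]` and a probability vector `w`,
`sampleArm w u` has distribution `w`. -/
def sampleArm {K : ℕ} [NeZero K] (w : Fin K → ℝ) (u : ℝ) : Fin K :=
  if h : (Finset.univ.filter fun j : Fin K => u < ∑ l ∈ Finset.Iic j, w l).Nonempty
  then (Finset.univ.filter fun j : Fin K => u < ∑ l ∈ Finset.Iic j, w l).min' h
  else 0

/-- Observations when the learner `L` plays against the hidden vector `θ`, the contexts `x`, the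
noises `e`, and with internal randomness `u`. After `k` batches exactly the entries at times
`t < grid k` are in place; the others are placeholders, which no policy can read. -/
def BatchLearner.log {d K T : ℕ} [NeZero K] (L : BatchLearner d K T)
    (θ : EuclideanSpace ℝ (Fin d)) (x : Fin T → Ctx d K) (u e : Fin T → ℝ) :
    ℕ → Fin T → Obs d K
  | 0 => fun t => (x t, 0, 0)
  | k + 1 => fun t =>
      if (t : ℕ) < L.grid k then L.log θ x u e k t
      else if (t : ℕ) < L.grid (k + 1) then
        let i := sampleArm (L.policy k (fun s => L.log θ x u e k s.1) (x t)) (u t)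
        (x t, i, inner ℝ (x t i) θ + e t)
      else (x t, 0, 0)

/-- The arm `i_t` played at time `t`. -/
def BatchLearner.arm {d K T : ℕ} [NeZero K] (L : BatchLearner d K T)
    (θ : EuclideanSpace ℝ (Fin d)) (x : Fin T → Ctx d K) (u e : Fin T → ℝ) (t : Fin T) : Fin K :=
  (L.log θ x u e L.numBatches t).2.1

/-- `∑ₜ (maxᵢ xₜᵢᵀθ - xₜ,ᵢₜᵀθ)`. -/
def BatchLearner.regret {d K T : ℕ} [NeZero K] (L : BatchLearner d K T)
    (θ : EuclideanSpace ℝ (Fin d)) (x : Fin T → Ctx d K) (u e : Fin T → ℝ) : ℝ :=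
  ∑ t : Fin T, ((⨆ i : Fin K, inner ℝ (x t i) θ) - inner ℝ (x t (L.arm θ x u e t)) θ)

/-! ### The environment with stochastic contexts -/

/-- Stochastic contexts: at each time `t` the context vectors `X t` have law `D`, the internal
randomness `U t` of the learner is uniform on `[0, 1]`, the noise `ε t` has law `ν t`, and all
these random elements (over all `t`) are mutually independent. The contexts have norm at most `1`
almost surely and the noises are sub-Gaussian with variance proxy `1`. -/
structure IsStochasticBandit {d K T : ℕ} {Ω : Type*} [MeasurableSpace Ω] (P : Measure Ω)
    (D : Measure (Ctx d K)) (ν : Fin T → Measure ℝ)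
    (X : Fin T → Ω → Ctx d K) (U ε : Fin T → Ω → ℝ) : Prop where
  measurable_X : ∀ t, Measurable (X t)
  measurable_U : ∀ t, Measurable (U t)
  measurable_ε : ∀ t, Measurable (ε t)
  law : ∀ t, P.map (fun ω => (X t ω, U t ω, ε t ω)) =
    D.prod ((volume.restrict (Set.Icc (0 : ℝ) 1)).prod (ν t))
  indep : iIndepFun (fun t ω => (X t ω, U t ω, ε t ω)) P
  norm_le : ∀ᵐ x ∂D, ∀ i, ‖x i‖ ≤ 1
  subgaussian : ∀ t, HasSubgaussianMGF id 1 (ν t)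

/-- The `(1 - δ)`-high probability expected regret of a regret variable `R`: the supremum of
`E[1_A R]` over all events `A` of probability at least `1 - δ`. -/
def highProbExpectedRegret {Ω : Type*} [MeasurableSpace Ω] (P : Measure Ω) (δ : ℝ) (R : Ω → ℝ) :
    EReal :=
  ⨆ (A : Set Ω) (_ : MeasurableSet A) (_ : 1 - δ ≤ P.real A), ((∫ ω in A, R ω ∂P : ℝ) : EReal)

/-! ### G-optimal designs and the algorithm -/

/-- A (measurable) rule that computes, for context vectors `x` and a nonempty set `A` of arms, a
distribution on `X = {x i : i ∈ A}` (written as weights of the arms) which is a G-optimal design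
up to a factor of `2`:
`max_{x ∈ X} xᵀ (ε I + E_y y yᵀ)⁻¹ x ≤ 2 d` for all `ε > 0`. -/
structure GDesignRule (d K : ℕ) where
  weight : Ctx d K → Finset (Fin K) → Fin K → ℝ
  measurable_weight : ∀ A i, Measurable fun x => weight x A i
  nonneg : ∀ x A i, 0 ≤ weight x A i
  eq_zero : ∀ x A i, i ∉ A → weight x A i = 0
  sum_eq_one : ∀ x A, A.Nonempty → ∑ i ∈ A, weight x A i = 1
  variance_le : ∀ x A, A.Nonempty → ∀ ε : ℝ, 0 < ε → ∀ i ∈ A,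
    invQuad (ε • (1 : Matrix (Fin d) (Fin d) ℝ) + ∑ j ∈ A, weight x A j • outer (x j)) (x i)
      ≤ 2 * d

/-- `M = ⌈log₂ log₂ T⌉`. -/
def kwNumBatches (T : ℕ) : ℕ := ⌈Real.logb 2 (Real.logb 2 (T : ℝ))⌉₊

/-- `𝒯₀ = 0`, `𝒯ᵢ = ⌊T ^ (1 - 2⁻ⁱ)⌋` for `1 ≤ i < M`, and `𝒯_M = T`. -/
def kwGrid (T i : ℕ) : ℕ :=
  if i = 0 then 0
  else if i < kwNumBatches T then ⌊(T : ℝ) ^ (1 - (2 : ℝ)⁻¹ ^ i)⌋₊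
  else T

/-- `α = 10 √(ln (2dKT/δ))`. -/
def kwAlpha (d K T : ℕ) (δ : ℝ) : ℝ := 10 * √(Real.log (2 * d * K * T / δ))

/-- `λ = 16 ln (2dT/δ)`. -/
def kwLambda (d T : ℕ) (δ : ℝ) : ℝ := 16 * Real.log (2 * d * T / δ)

section Estimates

variable {d K T n : ℕ}

/-- `Λ = λ I + ∑ xₜ xₜᵀ`, the sum over the time steps `t` of batch `κ`. -/
def kwInfo (δ : ℝ) (h : {t : Fin T // (t : ℕ) < n} → Obs d K) (κ : ℕ) :
    Matrix (Fin d) (Fin d) ℝ :=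
  kwLambda d T δ • (1 : Matrix (Fin d) (Fin d) ℝ) +
    ∑ t with kwGrid T κ ≤ (t.1 : ℕ) ∧ (t.1 : ℕ) < kwGrid T (κ + 1), outer (h t).played

/-- `ξ = ∑ rₜ xₜ`, the sum over the time steps `t` of batch `κ`. -/
def kwXi (h : {t : Fin T // (t : ℕ) < n} → Obs d K) (κ : ℕ) : EuclideanSpace ℝ (Fin d) :=
  ∑ t with kwGrid T κ ≤ (t.1 : ℕ) ∧ (t.1 : ℕ) < kwGrid T (κ + 1), (h t).reward • (h t).played

/-- `θ̂ = Λ⁻¹ ξ`, the ridge regression estimate from batch `κ`. -/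
def kwTheta (δ : ℝ) (h : {t : Fin T // (t : ℕ) < n} → Obs d K) (κ : ℕ) :
    EuclideanSpace ℝ (Fin d) :=
  WithLp.toLp 2 (Matrix.mulVec (kwInfo δ h κ)⁻¹ (kwXi h κ).ofLp)

/-- The estimated reward `r̂ᵢ = xᵢᵀ θ̂` from batch `κ`. -/
def kwReward (δ : ℝ) (h : {t : Fin T // (t : ℕ) < n} → Obs d K) (x : Ctx d K) (κ : ℕ)
    (i : Fin K) : ℝ :=
  inner ℝ (x i) (kwTheta δ h κ)

/-- The confidence width `ωᵢ = α √(xᵢᵀ Λ⁻¹ xᵢ)` from batch `κ`. -/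
def kwWidth (δ : ℝ) (h : {t : Fin T // (t : ℕ) < n} → Obs d K) (x : Ctx d K) (κ : ℕ)
    (i : Fin K) : ℝ :=
  kwAlpha d K T δ * √(invQuad (kwInfo δ h κ) (x i))

open Classical in
/-- The arms that survive the elimination by the batches `0, …, k - 1`, one after the other. -/
def kwSurvivors (δ : ℝ) (h : {t : Fin T // (t : ℕ) < n} → Obs d K) (x : Ctx d K) :
    ℕ → Finset (Fin K)
  | 0 => Finset.univ
  | κ + 1 => (kwSurvivors δ h x κ).filter fun i => ∀ j ∈ kwSurvivors δ h x κ,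
      kwReward δ h x κ j - kwWidth δ h x κ j ≤ kwReward δ h x κ i + kwWidth δ h x κ i

end Estimates

/-- BatchLinUCB-KW: in each batch, eliminate arms with the estimates of the earlier batches and
draw the arm from the G-optimal design of the surviving context vectors. -/
def batchLinUCBKW {d K : ℕ} (T : ℕ) (δ : ℝ) (G : GDesignRule d K) : BatchLearner d K T where
  numBatches := kwNumBatches T
  grid := kwGrid T
  policy k h x := G.weight x (kwSurvivors δ h x k)

end BatchLinBandit

end

/-! The regret is nonnegative, so `E[1_A Reg] ≤ E[Reg]` for every event `A`, and it suffices to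
bound the full expectation. This is done on the canonical space `Sample`, where contexts, sampling
variables and noises are independent coordinates.

Confidence. The Gram matrix `Λ` of a batch is a function of the contexts, the sampling variables and
the noises before that batch. With these frozen, the estimation error at `x` is a fixed linear form
in the noises of the batch, whose squared coefficients sum to at most `xᵀΛ⁻¹x`, minus a bias of size
at most `√λ √(xᵀΛ⁻¹x)`. Hence wrong intervals are rare (`sampleLaw_badSet_le`). When all intervals
are right, the best arm survives, and the regret of a surviving arm is at most twice its own last
width plus twice that of the best arm.

Width. Both arms lie in the set on which the design of batch `k` is drawn for the current contexts.
By G-optimality and a trace inequality their quadratic forms are at most `2d` times the average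
under that design (`invQuad_le_sum_weight`). In expectation this average is controlled by the form
at a virtual play of the policy of batch `k` at the later time `t`. Given what precedes batch `k`,
the virtual play is exchangeable with the `n` real plays of the batch. The `n + 1` forms taken in
the joint Gram matrix sum to at most `d`, so each has mean at most `d / (n + 1)`; including the
virtual play in the matrix costs a factor `2` because `λ ≥ 1` (`mul_lintegral_designVar_le`). So the
expected width is of order `α d / √n`, without any matrix concentration.

Grid. Each unrounded end point is `√T` times the square root of the previous one, so the length of a
batch over the square root of the preceding length is at most `4√T`. Every batch then costs `O(α d
√T)`, up to a negligible failure term, and there are `O(log log T)` batches.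

Existence of designs. Among tuples of `2d` arms, one that maximizes the determinant of the
regularized covariance is a design, by an exchange argument; measurability comes from choosing among
finitely many tuples. -/

noncomputable section

namespace BatchLinBandit

open Matrix

/-! ### Quadratic forms of inverse matrices and the trace inequality for designs. -/

section LinearAlgebra

variable {d : ℕ}

lemma PosDef.mulVec_inv_mulVec {N : Matrix (Fin d) (Fin d) ℝ} (hN : N.PosDef) (x : Fin d → ℝ) :
    N *ᵥ (N⁻¹ *ᵥ x) = x := by
  rw [mulVec_mulVec, Matrix.mul_nonsing_inv _ ((Matrix.isUnit_iff_isUnit_det _).1 hN.isUnit),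
    one_mulVec]

lemma PosDef.dotProduct_mulVec_comm {N : Matrix (Fin d) (Fin d) ℝ} (hN : N.PosDef)
    (x y : Fin d → ℝ) : x ⬝ᵥ N *ᵥ y = y ⬝ᵥ N *ᵥ x := by
  have h : Nᵀ = N := by simpa using hN.isHermitian.eq
  rw [dotProduct_mulVec, ← mulVec_transpose, h, dotProduct_comm]

lemma PosDef.dotProduct_inv_nonneg {N : Matrix (Fin d) (Fin d) ℝ} (hN : N.PosDef)
    (x : Fin d → ℝ) : 0 ≤ x ⬝ᵥ N⁻¹ *ᵥ x := by
  simpa using hN.inv.posSemidef.dotProduct_mulVec_nonneg x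

lemma PosDef.dotProduct_nonneg {N : Matrix (Fin d) (Fin d) ℝ} (hN : N.PosDef)
    (x : Fin d → ℝ) : 0 ≤ x ⬝ᵥ N *ᵥ x := by
  simpa using hN.posSemidef.dotProduct_mulVec_nonneg x

/-- Cauchy–Schwarz inequality for the dual pair of norms of a positive definite matrix. -/
lemma PosDef.sq_dotProduct_le {N : Matrix (Fin d) (Fin d) ℝ} (hN : N.PosDef)
    (x v : Fin d → ℝ) : (x ⬝ᵥ v) ^ 2 ≤ (v ⬝ᵥ N *ᵥ v) * (x ⬝ᵥ N⁻¹ *ᵥ x) := by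
  set y := N⁻¹ *ᵥ x with hy
  have hx : N *ᵥ y = x := PosDef.mulVec_inv_mulVec hN x
  have key : ∀ s : ℝ, 0 ≤ (v ⬝ᵥ N *ᵥ v) * (s * s) + (-2 * (x ⬝ᵥ v)) * s + x ⬝ᵥ y := by
    intro s
    have h := PosDef.dotProduct_nonneg hN (y - s • v)
    have e : (y - s • v) ⬝ᵥ N *ᵥ (y - s • v)
        = (v ⬝ᵥ N *ᵥ v) * (s * s) + (-2 * (x ⬝ᵥ v)) * s + x ⬝ᵥ y := by
      have h1 : y ⬝ᵥ N *ᵥ v = x ⬝ᵥ v := by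
        rw [PosDef.dotProduct_mulVec_comm hN, hx, dotProduct_comm]
      simp only [mulVec_sub, mulVec_smul, sub_dotProduct, dotProduct_sub, smul_dotProduct,
        dotProduct_smul, smul_eq_mul, hx, h1, dotProduct_comm v x, dotProduct_comm y x]
      ring
    linarith
  have := discrim_le_zero key
  unfold discrim at this
  nlinarith

/-- Inversion reverses the Loewner order. -/
lemma PosDef.inv_antitone {A B : Matrix (Fin d) (Fin d) ℝ} (hA : A.PosDef) (hB : B.PosDef)
    {c : ℝ} (h : ∀ v, v ⬝ᵥ A *ᵥ v ≤ c * (v ⬝ᵥ B *ᵥ v)) (x : Fin d → ℝ) :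
    x ⬝ᵥ B⁻¹ *ᵥ x ≤ c * (x ⬝ᵥ A⁻¹ *ᵥ x) := by
  -- Write `q_M = xᵀM⁻¹x` and `v = B⁻¹x`. Cauchy–Schwarz for `A` and the hypothesis give `q_B² ≤
  -- (vᵀAv) q_A ≤ c q_B q_A`; it remains to cancel `q_B`, which vanishes only for `x = 0`.
  have h1 := PosDef.sq_dotProduct_le hA x (B⁻¹ *ᵥ x)
  have h2 : (B⁻¹ *ᵥ x) ⬝ᵥ B *ᵥ (B⁻¹ *ᵥ x) = x ⬝ᵥ B⁻¹ *ᵥ x := by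
    rw [PosDef.mulVec_inv_mulVec hB, dotProduct_comm]
  have h3 := h (B⁻¹ *ᵥ x)
  rw [h2] at h3
  have h0 := PosDef.dotProduct_inv_nonneg hB x
  have hA0 := PosDef.dotProduct_inv_nonneg hA x
  rcases h0.eq_or_lt with h0 | h0
  · rw [← h0] at h3 ⊢
    by_cases hx : x = 0
    · simp [hx]
    · have := hB.inv.dotProduct_mulVec_pos hx
      simp only [star_trivial] at this
      linarith
  · have h4 := h1.trans (mul_le_mul_of_nonneg_right h3 hA0)
    rw [pow_two, mul_right_comm] at h4
    exact le_of_mul_le_mul_right h4 h0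

lemma dotProduct_outer_mulVec (x : EuclideanSpace ℝ (Fin d)) (v w : Fin d → ℝ) :
    v ⬝ᵥ outer x *ᵥ w = (x.ofLp ⬝ᵥ v) * (x.ofLp ⬝ᵥ w) := by
  simp [outer, vecMulVec_mulVec, dotProduct_comm v, mul_comm]

lemma outer_posSemidef (x : EuclideanSpace ℝ (Fin d)) : (outer x).PosSemidef := by
  simpa [outer] using Matrix.posSemidef_vecMulVec_self_star x.ofLp

lemma smul_one_add_posDef {ε : ℝ} (hε : 0 < ε) {S : Matrix (Fin d) (Fin d) ℝ}
    (hS : S.PosSemidef) : (ε • (1 : Matrix (Fin d) (Fin d) ℝ) + S).PosDef :=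
  (Matrix.PosDef.one.smul hε).add_posSemidef hS

lemma sum_outer_posSemidef {ι : Type*} (s : Finset ι) (w : ι → ℝ) (hw : ∀ i ∈ s, 0 ≤ w i)
    (x : ι → EuclideanSpace ℝ (Fin d)) : (∑ i ∈ s, w i • outer (x i)).PosSemidef :=
  Matrix.posSemidef_sum s fun i hi => (outer_posSemidef (x i)).smul (hw i hi)

lemma sum_outer_posSemidef' {ι : Type*} (s : Finset ι)
    (x : ι → EuclideanSpace ℝ (Fin d)) : (∑ i ∈ s, outer (x i)).PosSemidef :=
  Matrix.posSemidef_sum s fun i _ => outer_posSemidef (x i)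

lemma trace_inv_mul_outer (N : Matrix (Fin d) (Fin d) ℝ) (x : EuclideanSpace ℝ (Fin d)) :
    (N⁻¹ * outer x).trace = invQuad N x := by
  rw [outer, mul_vecMulVec, trace_vecMulVec, invQuad, dotProduct_comm]

/-- Decomposing `S` into rank-one terms makes the trace a sum of values of the form of `N⁻¹`. This
lets Loewner inequalities be integrated against `N⁻¹`. -/
lemma trace_inv_mul_nonneg {N S : Matrix (Fin d) (Fin d) ℝ} (hN : N.PosDef)
    (hS : S.PosSemidef) : 0 ≤ (N⁻¹ * S).trace := by
  obtain ⟨m, v, hv⟩ := Matrix.posSemidef_iff_eq_sum_vecMulVec.1 hS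
  rw [hv, Finset.mul_sum, trace_sum]
  refine Finset.sum_nonneg fun i _ => ?_
  rw [mul_vecMulVec, trace_vecMulVec, dotProduct_comm]
  simpa using PosDef.dotProduct_inv_nonneg hN (v i)

lemma invQuad_nonneg {N : Matrix (Fin d) (Fin d) ℝ} (hN : N.PosDef)
    (x : EuclideanSpace ℝ (Fin d)) : 0 ≤ invQuad N x :=
  PosDef.dotProduct_inv_nonneg hN x

/-- The quadratic forms of the summands of a regularized Gram matrix add up to at most `d`. -/
lemma sum_mul_invQuad_le {ι : Type*} (s : Finset ι) (w : ι → ℝ) (hw : ∀ i ∈ s, 0 ≤ w i)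
    (x : ι → EuclideanSpace ℝ (Fin d)) {ε : ℝ} (hε : 0 < ε) :
    ∑ i ∈ s, w i * invQuad (ε • (1 : Matrix (Fin d) (Fin d) ℝ) + ∑ i ∈ s, w i • outer (x i)) (x i)
      ≤ d := by
  set S := ∑ i ∈ s, w i • outer (x i) with hS
  have hN := smul_one_add_posDef hε (sum_outer_posSemidef s w hw x)
  rw [← hS] at hN
  set N := ε • (1 : Matrix (Fin d) (Fin d) ℝ) + S with hNdef
  have h1 : ∑ i ∈ s, w i * invQuad N (x i) = (N⁻¹ * S).trace := by
    rw [hS, Finset.mul_sum, trace_sum]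
    refine Finset.sum_congr rfl fun i _ => ?_
    rw [Matrix.mul_smul, trace_smul, trace_inv_mul_outer, smul_eq_mul]
  have h2 : (N⁻¹ * N).trace = d := by
    rw [Matrix.nonsing_inv_mul _ ((Matrix.isUnit_iff_isUnit_det _).1 hN.isUnit), trace_one,
      Fintype.card_fin]
  have h3 : (N⁻¹ * N).trace = ε * (N⁻¹).trace + (N⁻¹ * S).trace := by
    have : N⁻¹ * N = ε • N⁻¹ + N⁻¹ * S := by
      nth_rw 2 [hNdef]
      rw [mul_add, Matrix.mul_smul, mul_one]
    rw [this, trace_add, trace_smul, smul_eq_mul]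
  have h4 := hN.inv.posSemidef.trace_nonneg
  rw [h1]
  nlinarith

/-- A bound on the quadratic form of `N⁻¹` at `x` transfers to every other positive matrix. -/
lemma invQuad_le_mul_trace {N A : Matrix (Fin d) (Fin d) ℝ} (hN : N.PosDef) (hA : A.PosDef)
    {c : ℝ} (x : EuclideanSpace ℝ (Fin d)) (hc : invQuad N x ≤ c) :
    invQuad A x ≤ c * (A⁻¹ * N).trace := by
  -- By Cauchy–Schwarz, `xᵀN⁻¹x ≤ c` gives `x xᵀ ≤ c N` in the Loewner order; the claim is the trace
  -- of this against `A⁻¹`.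
  have h : (c • N - outer x).PosSemidef := by
    refine Matrix.PosSemidef.of_dotProduct_mulVec_nonneg ?_ fun v => ?_
    · exact (hN.isHermitian.smul (k := c) (by simp [IsSelfAdjoint])).sub
        (outer_posSemidef x).isHermitian
    · have := PosDef.sq_dotProduct_le hN x.ofLp v
      have h0 := PosDef.dotProduct_nonneg hN v
      simp only [star_trivial, sub_mulVec, smul_mulVec, dotProduct_sub, dotProduct_smul,
        dotProduct_outer_mulVec, smul_eq_mul, ← pow_two]
      have h1 := mul_le_mul_of_nonneg_left hc h0
      unfold invQuad at h1
      nlinarith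
  have := trace_inv_mul_nonneg hA h
  rw [mul_sub, trace_sub, Matrix.mul_smul, trace_smul, trace_inv_mul_outer, smul_eq_mul] at this
  linarith

/-- The G-optimality of a design bounds the quadratic form of an arbitrary positive matrix by its
average under the design. -/
lemma invQuad_le_sum_weight {K : ℕ} (G : GDesignRule d K) (x : Ctx d K) {A : Finset (Fin K)}
    {Λ : Matrix (Fin d) (Fin d) ℝ} (hΛ : Λ.PosDef) {i : Fin K} (hi : i ∈ A) :
    invQuad Λ (x i) ≤ 2 * d * ∑ j, G.weight x A j * invQuad Λ (x j) := by
  have hsum : ∑ j, G.weight x A j * invQuad Λ (x j) =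
      ∑ j ∈ A, G.weight x A j * invQuad Λ (x j) := by
    symm
    refine Finset.sum_subset (Finset.subset_univ A) fun j _ hj => ?_
    rw [G.eq_zero x A j hj, zero_mul]
  rw [hsum]
  have h0 : 0 ≤ 2 * d * (Λ⁻¹).trace := mul_nonneg (by positivity) hΛ.inv.posSemidef.trace_nonneg
  -- The trace of `Λ⁻¹` times the covariance of the design is exactly the average; the
  -- regularization adds `ε tr Λ⁻¹`, which disappears as `ε → 0`.
  have key : ∀ ε : ℝ, 0 < ε → invQuad Λ (x i)
      ≤ 2 * d * ∑ j ∈ A, G.weight x A j * invQuad Λ (x j) + ε * (2 * d * (Λ⁻¹).trace) := by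
    intro ε hε
    have hN := smul_one_add_posDef hε
      (sum_outer_posSemidef A (G.weight x A) (fun j _ => G.nonneg x A j) x)
    have h := invQuad_le_mul_trace hN hΛ (x i) (G.variance_le x A ⟨i, hi⟩ ε hε i hi)
    rw [mul_add, trace_add, Matrix.mul_smul, mul_one, trace_smul, Finset.mul_sum, trace_sum] at h
    simp only [Matrix.mul_smul, trace_smul, trace_inv_mul_outer, smul_eq_mul] at h
    linarith
  refine le_of_forall_pos_le_add fun η hη => ?_
  have h := key (η / (2 * d * (Λ⁻¹).trace + 1)) (by positivity)
  refine h.trans (add_le_add_right ?_ _)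
  rw [div_mul_eq_mul_div, div_le_iff₀ (by positivity)]
  nlinarith

lemma dotProduct_self_eq_norm_sq (x : EuclideanSpace ℝ (Fin d)) :
    x.ofLp ⬝ᵥ x.ofLp = ‖x‖ ^ 2 := by
  rw [EuclideanSpace.real_norm_sq_eq]
  simp [dotProduct, pow_two]

lemma inner_eq_dotProduct (x y : EuclideanSpace ℝ (Fin d)) :
    inner ℝ x y = x.ofLp ⬝ᵥ y.ofLp := by
  simp [PiLp.inner_apply, dotProduct, mul_comm]

lemma dotProduct_smul_one_mulVec (c : ℝ) (v : Fin d → ℝ) :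
    v ⬝ᵥ (c • (1 : Matrix (Fin d) (Fin d) ℝ)) *ᵥ v = c * (v ⬝ᵥ v) := by
  simp [smul_mulVec]

lemma invQuad_smul_one_add_le {lam : ℝ} (hl : 0 < lam) {S : Matrix (Fin d) (Fin d) ℝ}
    (hS : S.PosSemidef) (x : EuclideanSpace ℝ (Fin d)) :
    invQuad (lam • (1 : Matrix (Fin d) (Fin d) ℝ) + S) x ≤ ‖x‖ ^ 2 / lam := by
  have h1 : (lam • (1 : Matrix (Fin d) (Fin d) ℝ)).PosDef := Matrix.PosDef.one.smul hl
  have h := PosDef.inv_antitone h1 (smul_one_add_posDef hl hS) (c := 1) (fun v => ?_) x.ofLp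
  · have h2 : (lam • (1 : Matrix (Fin d) (Fin d) ℝ))⁻¹ = lam⁻¹ • 1 := by
      rw [Matrix.inv_eq_left_inv]
      simp [smul_smul, mul_inv_cancel₀ hl.ne']
    rw [h2, dotProduct_smul_one_mulVec, dotProduct_self_eq_norm_sq] at h
    unfold invQuad
    refine h.trans (le_of_eq ?_)
    rw [one_mul, mul_comm, div_eq_mul_inv]
  · have := hS.dotProduct_mulVec_nonneg v
    simp only [star_trivial] at this
    rw [one_mul, add_mulVec, dotProduct_add]
    linarith

/-- Adding a short vector to a Gram matrix changes the quadratic form by a factor of at most `2`. -/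
lemma invQuad_le_two_mul_invQuad_add_outer {lam : ℝ} (hl : 1 ≤ lam)
    {S : Matrix (Fin d) (Fin d) ℝ} (hS : S.PosSemidef) (x y : EuclideanSpace ℝ (Fin d))
    (hy : ‖y‖ ≤ 1) :
    invQuad (lam • (1 : Matrix (Fin d) (Fin d) ℝ) + S) x
      ≤ 2 * invQuad (lam • (1 : Matrix (Fin d) (Fin d) ℝ) + (S + outer y)) x := by
  have hl0 : 0 < lam := by linarith
  refine PosDef.inv_antitone (smul_one_add_posDef hl0 (hS.add (outer_posSemidef y)))
    (smul_one_add_posDef hl0 hS) (fun v => ?_) x.ofLp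
  have h1 := hS.dotProduct_mulVec_nonneg v
  simp only [star_trivial] at h1
  -- Since `(y·v)² ≤ v·v ≤ lam (v·v)`, the new term is dominated by the regularization already
  -- present, so the form at most doubles.
  have h2 : (y.ofLp ⬝ᵥ v) ^ 2 ≤ v ⬝ᵥ v := by
    have := abs_real_inner_le_norm y (WithLp.toLp 2 v)
    rw [inner_eq_dotProduct] at this
    have h3 := dotProduct_self_eq_norm_sq (WithLp.toLp 2 v)
    simp only at this h3
    rw [h3, sq_le_sq, abs_of_nonneg (norm_nonneg _)]
    exact this.trans (mul_le_of_le_one_left (norm_nonneg _) hy)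
  have h0 : 0 ≤ v ⬝ᵥ v := by
    simpa using dotProduct_star_self_nonneg v
  simp only [add_mulVec, dotProduct_add, dotProduct_smul_one_mulVec, dotProduct_outer_mulVec,
    ← pow_two]
  nlinarith

end LinearAlgebra

/-! ### Measurability of inverse matrices and quadratic forms. -/

section MatrixMeasurability

variable {α : Type*} [MeasurableSpace α] {d : ℕ}

lemma measurable_det {n : Type*} [Fintype n] [DecidableEq n] {M : α → Matrix n n ℝ}
    (hM : ∀ i j, Measurable fun a => M a i j) : Measurable fun a => (M a).det := by
  simp only [det_apply]
  refine Finset.measurable_sum _ fun σ _ => ?_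
  exact (Finset.measurable_prod _ fun i _ => hM _ _).const_smul _

lemma measurable_inv_entry {M : α → Matrix (Fin d) (Fin d) ℝ}
    (hM : ∀ i j, Measurable fun a => M a i j) (i j : Fin d) :
    Measurable fun a => (M a)⁻¹ i j := by
  simp only [Matrix.inv_def, Matrix.smul_apply, smul_eq_mul, Ring.inverse_eq_inv']
  refine (measurable_det hM).inv.mul ?_
  simp only [adjugate_apply]
  refine measurable_det fun k l => ?_
  simp only [updateRow_apply]
  split_ifs
  · exact measurable_const
  · exact hM _ _

lemma measurable_coord {v : α → EuclideanSpace ℝ (Fin d)} (hv : Measurable v) (i : Fin d) :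
    Measurable fun a => (v a).ofLp i :=
  (EuclideanSpace.proj (𝕜 := ℝ) i).continuous.measurable.comp hv

lemma measurable_euclidean {v : α → Fin d → ℝ} (hv : ∀ i, Measurable fun a => v a i) :
    Measurable fun a => (WithLp.toLp 2 (v a) : EuclideanSpace ℝ (Fin d)) :=
  (PiLp.continuous_toLp 2 _).measurable.comp (measurable_pi_lambda _ hv)

lemma measurable_outer_entry {v : α → EuclideanSpace ℝ (Fin d)} (hv : Measurable v)
    (i j : Fin d) : Measurable fun a => outer (v a) i j := by
  simp only [outer, vecMulVec_apply]
  exact (measurable_coord hv i).mul (measurable_coord hv j)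

lemma measurable_invQuad {M : α → Matrix (Fin d) (Fin d) ℝ}
    (hM : ∀ i j, Measurable fun a => M a i j) {v : α → EuclideanSpace ℝ (Fin d)}
    (hv : Measurable v) : Measurable fun a => invQuad (M a) (v a) := by
  simp only [invQuad, dotProduct, mulVec]
  exact Finset.measurable_sum _ fun i _ => (measurable_coord hv i).mul
    (Finset.measurable_sum _ fun j _ => (measurable_inv_entry hM i j).mul (measurable_coord hv j))

end MatrixMeasurability

/-! ### Existence of measurable G-optimal designs up to a factor of 2. -/

section DesignExistence

variable {d K : ℕ}

/-- The matrix determinant lemma. The sign of `a` is free, so it also serves to remove a vector. -/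
lemma det_add_smul_outer {N : Matrix (Fin d) (Fin d) ℝ} (hN : N.PosDef) (a : ℝ)
    (y : EuclideanSpace ℝ (Fin d)) :
    (N + a • outer y).det = N.det * (1 + a * invQuad N y) := by
  have h := Matrix.det_add_replicateCol_mul_replicateRow (ι := Unit)
    ((Matrix.isUnit_iff_isUnit_det _).1 hN.isUnit) (a • y.ofLp) y.ofLp
  have h1 : replicateCol Unit (a • y.ofLp) * replicateRow Unit y.ofLp = a • outer y := by
    ext i j
    simp [outer, Matrix.mul_apply, vecMulVec_apply, mul_assoc]
  rw [h1] at h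
  rw [h]
  congr 1
  rw [Matrix.det_unique]
  simp only [Matrix.add_apply, Matrix.one_apply_eq, invQuad]
  rw [Matrix.mul_assoc]
  simp only [Matrix.mul_apply, replicateRow_apply, replicateCol_apply, dotProduct, mulVec,
    Finset.mul_sum, Pi.smul_apply, smul_eq_mul]
  congr 1
  refine Finset.sum_congr rfl fun i _ => Finset.sum_congr rfl fun j _ => by ring

/-- The regularized covariance matrix of the uniform distribution on the arms `f 0, f 1, …`. -/
def tupleGram (x : Ctx d K) (f : Fin (2 * d) → Fin K) (ε : ℝ) : Matrix (Fin d) (Fin d) ℝ :=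
  ε • (1 : Matrix (Fin d) (Fin d) ℝ) + ∑ l, ((2 * d : ℝ)⁻¹) • outer (x (f l))

lemma tupleGram_posDef (x : Ctx d K) (f : Fin (2 * d) → Fin K) {ε : ℝ} (hε : 0 < ε) :
    (tupleGram x f ε).PosDef :=
  smul_one_add_posDef hε (sum_outer_posSemidef _ _ (fun _ _ => by positivity) _)

/-- Let `R` be the matrix with entry `l` removed, `N` the full one, `a = 1/(2d)`. Comparing
determinants over `R` bounds the form of `R⁻¹` at `x i` by that at `x (f l)`. Removing and restoring
entry `l` gives `(1 - a q_N)(1 + a q_R) = 1` at `x (f l)`. As `N ≥ R`, the form at `x i` may be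
taken in `N`, so the conclusion mentions `N` alone and can be summed over `l`. -/
lemma tupleGram_exchange [NeZero d] (x : Ctx d K) (f : Fin (2 * d) → Fin K) {ε : ℝ} (hε : 0 < ε)
    (l : Fin (2 * d)) (i : Fin K)
    (h : (tupleGram x (Function.update f l i) ε).det ≤ (tupleGram x f ε).det) :
    (1 - (2 * d : ℝ)⁻¹ * invQuad (tupleGram x f ε) (x (f l))) *
      (1 + (2 * d : ℝ)⁻¹ * invQuad (tupleGram x f ε) (x i)) ≤ 1 := by
  set a : ℝ := (2 * d : ℝ)⁻¹ with ha
  have ha0 : 0 < a := by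
    have := NeZero.pos d
    positivity
  set S := ∑ l' ∈ Finset.univ.erase l, a • outer (x (f l')) with hS
  have hSp : S.PosSemidef := sum_outer_posSemidef _ (fun _ => a) (fun _ _ => ha0.le) _
  set R := ε • (1 : Matrix (Fin d) (Fin d) ℝ) + S with hR
  have hRp : R.PosDef := smul_one_add_posDef hε hSp
  have hN : tupleGram x f ε = R + a • outer (x (f l)) := by
    rw [tupleGram, ← Finset.sum_erase_add _ _ (Finset.mem_univ l), ← add_assoc]
  have hN' : tupleGram x (Function.update f l i) ε = R + a • outer (x i) := by
    rw [tupleGram, ← Finset.sum_erase_add _ _ (Finset.mem_univ l), ← add_assoc,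
      Function.update_self, hR, hS]
    congr 2
    refine Finset.sum_congr rfl fun l' hl' => ?_
    rw [Function.update_of_ne (Finset.ne_of_mem_erase hl')]
  have hNp := tupleGram_posDef x f hε
  set N := tupleGram x f ε with hNd
  have hd1 := det_add_smul_outer hRp a (x (f l))
  have hd2 := det_add_smul_outer hRp a (x i)
  have hd3 := det_add_smul_outer hNp (-a) (x (f l))
  have hRN : N + (-a) • outer (x (f l)) = R := by rw [hN]; simp
  rw [hRN] at hd3
  rw [hN', hd2, hN, hd1] at h
  rw [← hN] at hd1
  have hRd : 0 < R.det := hRp.det_pos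
  have hNdet : 0 < N.det := hNp.det_pos
  have h1 : 1 + a * invQuad R (x i) ≤ 1 + a * invQuad R (x (f l)) :=
    le_of_mul_le_mul_left h hRd
  have h2 : invQuad N (x i) ≤ invQuad R (x i) := by
    have := PosDef.inv_antitone (A := R) (B := N) (c := 1) hRp hNp (fun v => ?_) (x i).ofLp
    · rwa [one_mul] at this
    · have h5 : v ⬝ᵥ N *ᵥ v = v ⬝ᵥ R *ᵥ v + a * ((x (f l)).ofLp ⬝ᵥ v * ((x (f l)).ofLp ⬝ᵥ v)) := by
        rw [hN, add_mulVec R, dotProduct_add, smul_mulVec, dotProduct_smul,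
          dotProduct_outer_mulVec, smul_eq_mul]
      rw [h5, one_mul]
      nlinarith [mul_self_nonneg ((x (f l)).ofLp ⬝ᵥ v)]
  have h3 : 0 < 1 - a * invQuad N (x (f l)) := by
    have : 0 < N.det * (1 + -a * invQuad N (x (f l))) := hd3 ▸ hRd
    have := (mul_pos_iff_of_pos_left hNdet).1 this
    linarith
  have h4 : (1 - a * invQuad N (x (f l))) * (1 + a * invQuad R (x (f l))) = 1 := by
    have h5 : N.det * ((1 - a * invQuad N (x (f l))) * (1 + a * invQuad R (x (f l))))
        = N.det * 1 := by
      rw [mul_one]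
      conv_rhs => rw [hd1, hd3]
      ring
    exact mul_left_cancel₀ hNdet.ne' h5
  refine (mul_le_mul_of_nonneg_left (le_trans ?_ h1) h3.le).trans h4.le
  have := mul_le_mul_of_nonneg_left h2 ha0.le
  linarith

/-- A tuple of `2d` arms which maximizes the determinant is a G-optimal design up to a factor
of `2`. -/
lemma exists_tuple_invQuad_le [NeZero d] (x : Ctx d K) {A : Finset (Fin K)} (hA : A.Nonempty)
    {ε : ℝ} (hε : 0 < ε) :
    ∃ f : Fin (2 * d) → Fin K, (∀ l, f l ∈ A) ∧
      ∀ i ∈ A, invQuad (tupleGram x f ε) (x i) ≤ 2 * d := by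
  obtain ⟨i₀, hi₀⟩ := hA
  obtain ⟨f, hf, hmax⟩ := Finset.exists_max_image (Fintype.piFinset fun _ : Fin (2 * d) => A)
    (fun f => (tupleGram x f ε).det) ⟨fun _ => i₀, by simp [hi₀]⟩
  rw [Fintype.mem_piFinset] at hf
  refine ⟨f, hf, fun i hi => ?_⟩
  have hd : (0 : ℝ) < d := by exact_mod_cast NeZero.pos d
  have hex := fun l => tupleGram_exchange x f hε l i (hmax _ (by
    rw [Fintype.mem_piFinset]
    intro l'
    by_cases h : l' = l
    · subst h; simpa using hi
    · simpa [Function.update_of_ne h] using hf l'))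
  -- In the sum over `l` the first factors total at least `2d - d`, because the weighted forms of
  -- the tuple sum to at most `d` (`htr`). Hence `d (1 + q/(2d)) ≤ 2d`, that is `q ≤ 2d`.
  have hsum := Finset.sum_le_sum fun l (_ : l ∈ Finset.univ) => hex l
  rw [← Finset.sum_mul, Finset.sum_sub_distrib] at hsum
  simp only [Finset.sum_const, Finset.card_univ, Fintype.card_fin, nsmul_eq_mul, mul_one] at hsum
  have htr := sum_mul_invQuad_le Finset.univ (fun _ : Fin (2 * d) => (2 * d : ℝ)⁻¹)
    (fun _ _ => by positivity) (fun l => x (f l)) hε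
  change ∑ l, (2 * d : ℝ)⁻¹ * invQuad (tupleGram x f ε) (x (f l)) ≤ d at htr
  have hq := invQuad_nonneg (tupleGram_posDef x f hε) (x i)
  push_cast at hsum
  set q := invQuad (tupleGram x f ε) (x i)
  have h1 : (d : ℝ) * (1 + (2 * d : ℝ)⁻¹ * q) ≤ 2 * d := by
    refine le_trans (mul_le_mul_of_nonneg_right ?_ (by positivity)) hsum
    linarith
  have h2 : (d : ℝ) * (1 + (2 * d : ℝ)⁻¹ * q) = d + q / 2 := by field_simp
  linarith

/-- Monotonicity in the regularization reduces the bound for all `ε > 0` to arbitrarily small `ε`,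
hence to the sequence `1 / (m + 1)`. -/
lemma invQuad_tupleGram_antitone (x : Ctx d K) (f : Fin (2 * d) → Fin K) {ε ε' : ℝ} (hε : 0 < ε)
    (h : ε ≤ ε') (y : EuclideanSpace ℝ (Fin d)) :
    invQuad (tupleGram x f ε') y ≤ invQuad (tupleGram x f ε) y := by
  have := PosDef.inv_antitone (c := 1) (tupleGram_posDef x f hε)
    (tupleGram_posDef x f (hε.trans_le h)) (fun v => ?_) y.ofLp
  · rwa [one_mul] at this
  · have h0 : 0 ≤ v ⬝ᵥ v := by simpa using dotProduct_star_self_nonneg v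
    simp only [tupleGram, add_mulVec, dotProduct_add, dotProduct_smul_one_mulVec, one_mul]
    nlinarith

/-- The tuple `f` is a design on the arms in `A` for all regularizations `1 / (m + 1)`. -/
def IsTupleDesign (A : Finset (Fin K)) (f : Fin (2 * d) → Fin K) (x : Ctx d K) : Prop :=
  (∀ l, f l ∈ A) ∧ ∀ m : ℕ, ∀ i ∈ A, invQuad (tupleGram x f (1 / ((m : ℝ) + 1))) (x i) ≤ 2 * d

/-- The maximizing tuple depends on `ε`. There are only finitely many tuples, so one of them is
optimal for infinitely many `m`, and monotonicity covers the other `m`. -/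
lemma exists_isTupleDesign [NeZero d] (x : Ctx d K) {A : Finset (Fin K)} (hA : A.Nonempty) :
    ∃ f : Fin (2 * d) → Fin K, IsTupleDesign A f x := by
  choose g hgA hg using fun m : ℕ =>
    exists_tuple_invQuad_le x hA (ε := 1 / ((m : ℝ) + 1)) (by positivity)
  obtain ⟨f, hf⟩ := Finite.exists_infinite_fiber g
  have hinf : (g ⁻¹' {f}).Infinite := Set.infinite_coe_iff.1 hf
  obtain ⟨m₀, hm₀⟩ := hinf.nonempty
  refine ⟨f, fun l => ?_, fun m i hi => ?_⟩
  · rw [← (show g m₀ = f from hm₀)]; exact hgA m₀ l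
  · obtain ⟨m', hm', hlt⟩ := hinf.exists_gt m
    have h := hg m' i hi
    rw [show g m' = f from hm'] at h
    exact (invQuad_tupleGram_antitone x f (by positivity)
      (one_div_le_one_div_of_le (by positivity) (by
        have : (m : ℝ) < m' := by exact_mod_cast hlt
        linarith)) _).trans h

lemma measurable_context (i : Fin K) : Measurable fun x : Ctx d K => x i := measurable_pi_apply i

lemma measurableSet_isTupleDesign (A : Finset (Fin K)) (f : Fin (2 * d) → Fin K) :
    MeasurableSet {x : Ctx d K | IsTupleDesign A f x} := by
  refine measurableSet_setOfPred.2 (measurable_const.and ?_)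
  refine Measurable.forall fun m => Measurable.forall fun i => Measurable.forall fun _ => ?_
  refine measurableSet_setOfPred.1 (measurableSet_le (measurable_invQuad (fun k l => ?_)
    (measurable_context i)) measurable_const)
  simp only [tupleGram, Matrix.add_apply, Matrix.sum_apply, Matrix.smul_apply]
  exact measurable_const.add (Finset.measurable_sum _ fun l' _ =>
    (measurable_outer_entry (measurable_context (f l')) k l).const_smul ((2 * d : ℝ)⁻¹))

/-- The weights of the arms in the uniform distribution on a tuple. -/
def tupleWeight (f : Fin (2 * d) → Fin K) (i : Fin K) : ℝ :=
  ∑ l, if f l = i then (2 * d : ℝ)⁻¹ else 0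

lemma sum_tupleWeight_smul {M : Type*} [AddCommGroup M] [Module ℝ M] {A : Finset (Fin K)}
    {f : Fin (2 * d) → Fin K} (hf : ∀ l, f l ∈ A) (φ : Fin K → M) :
    ∑ i ∈ A, tupleWeight f i • φ i = ∑ l, (2 * d : ℝ)⁻¹ • φ (f l) := by
  simp only [tupleWeight, Finset.sum_smul, ite_smul, zero_smul]
  rw [Finset.sum_comm]
  refine Finset.sum_congr rfl fun l _ => ?_
  rw [Finset.sum_ite_eq, if_pos (hf l)]

/-- Taking the first valid tuple in a fixed enumeration is measurable, since validity of each tuple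
is a measurable condition on the contexts. -/
lemma exists_measurable_tuple [NeZero d] {A : Finset (Fin K)} (hA : A.Nonempty) :
    ∃ W : Ctx d K → Fin K → ℝ, (∀ i, Measurable fun x => W x i) ∧
      ∀ x, ∃ f, IsTupleDesign A f x ∧ W x = tupleWeight f := by
  classical
  obtain ⟨i₀, hi₀⟩ := hA
  let e := Fintype.equivFin (Fin (2 * d) → Fin K)
  let dec : ℕ → Fin (2 * d) → Fin K := fun n =>
    if h : n < Fintype.card (Fin (2 * d) → Fin K) then e.symm ⟨n, h⟩ else fun _ => i₀
  have hdec : ∀ f, ∃ n, dec n = f := fun f => ⟨e f, by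
    simp only [dec, dif_pos (e f).2, Fin.eta, Equiv.symm_apply_apply]⟩
  have hp : ∀ x : Ctx d K, ∃ n, IsTupleDesign A (dec n) x := fun x => by
    obtain ⟨f, hf⟩ := exists_isTupleDesign x ⟨i₀, hi₀⟩
    obtain ⟨n, rfl⟩ := hdec f
    exact ⟨n, hf⟩
  refine ⟨fun x => tupleWeight (dec (Nat.find (hp x))), fun i => ?_, fun x =>
    ⟨_, Nat.find_spec (hp x), rfl⟩⟩
  exact (measurable_from_nat (f := fun n => tupleWeight (dec n) i)).comp
    (measurable_find hp fun n => measurableSet_isTupleDesign A (dec n))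

/-- Measurable rules for G-optimal designs exist. -/
theorem nonempty_gDesignRule [NeZero d] : Nonempty (GDesignRule d K) := by
  classical
  choose W hWm f hf hWf using fun A : {A : Finset (Fin K) // A.Nonempty} =>
    (let ⟨W, h1, h2⟩ := exists_measurable_tuple (d := d) A.2
     let ⟨f, h3⟩ := Classical.axiom_of_choice h2
     (⟨W, h1, f, fun x => (h3 x).1, fun x => (h3 x).2⟩ :
      ∃ W : Ctx d K → Fin K → ℝ, (∀ i, Measurable fun x => W x i) ∧
      ∃ f : Ctx d K → Fin (2 * d) → Fin K, (∀ x, IsTupleDesign A.1 (f x) x) ∧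
        ∀ x, W x = tupleWeight (f x)))
  have hd : (0 : ℝ) < d := by exact_mod_cast NeZero.pos d
  refine ⟨⟨fun x A i => if h : A.Nonempty then W ⟨A, h⟩ x i else 0, fun A i => ?_,
    fun x A i => ?_, fun x A i hi => ?_, fun x A hA => ?_, fun x A hA ε hε i hi => ?_⟩⟩
  · split_ifs with h
    · exact hWm _ i
    · exact measurable_const
  · split_ifs with h
    · rw [hWf]
      exact Finset.sum_nonneg fun l _ => by split_ifs <;> positivity
    · exact le_rfl
  · split_ifs with h
    · rw [hWf]
      refine Finset.sum_eq_zero fun l _ => if_neg ?_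
      rintro rfl
      exact hi ((hf ⟨A, h⟩ x).1 l)
    · rfl
  · simp only [dif_pos hA, hWf]
    have := sum_tupleWeight_smul (hf ⟨A, hA⟩ x).1 (fun _ => (1 : ℝ))
    simp only [smul_eq_mul, mul_one] at this
    rw [this]
    simp
    field_simp
  · simp only [dif_pos hA, hWf]
    rw [sum_tupleWeight_smul (hf ⟨A, hA⟩ x).1 (fun j => outer (x j))]
    obtain ⟨m, hm⟩ := exists_nat_one_div_lt hε
    exact (invQuad_tupleGram_antitone x _ (by positivity) hm.le _).trans
      ((hf ⟨A, hA⟩ x).2 m i hi)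

end DesignExistence

/-! ### Inverse-CDF sampling of the arm. -/

section Sampling

lemma sum_Iic_eq_sum_Iio_add {K : ℕ} (w : Fin K → ℝ) (j : Fin K) :
    ∑ l ∈ Finset.Iic j, w l = ∑ l ∈ Finset.Iio j, w l + w j := by
  rw [← Finset.Iio_insert, Finset.sum_insert (by simp), add_comm]

variable {K : ℕ} [NeZero K]

lemma sampleArm_eq {w : Fin K → ℝ} (hw : ∀ i, 0 ≤ w i) {u : ℝ} {j : Fin K}
    (h1 : ∑ l ∈ Finset.Iio j, w l ≤ u) (h2 : u < ∑ l ∈ Finset.Iic j, w l) :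
    sampleArm w u = j := by
  classical
  have hj : j ∈ Finset.univ.filter fun j : Fin K => u < ∑ l ∈ Finset.Iic j, w l := by simpa using h2
  have hne : (Finset.univ.filter fun j : Fin K => u < ∑ l ∈ Finset.Iic j, w l).Nonempty := ⟨j, hj⟩
  unfold sampleArm
  split_ifs
  · refine le_antisymm (Finset.min'_le _ _ (by simpa using h2))
      (Finset.le_min' _ _ _ fun i hi => ?_)
    by_contra! hlt
    have hi' : u < ∑ l ∈ Finset.Iic i, w l := by simpa using hi
    have : ∑ l ∈ Finset.Iic i, w l ≤ ∑ l ∈ Finset.Iio j, w l :=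
      Finset.sum_le_sum_of_subset_of_nonneg (fun l hl => by
        simp only [Finset.mem_Iic, Finset.mem_Iio] at *
        exact hl.trans_lt hlt) fun l _ _ => hw l
    linarith

lemma sampleArm_weight_pos {w : Fin K → ℝ} (hsum : 1 ≤ ∑ i, w i) {u : ℝ}
    (h0 : 0 ≤ u) (h1 : u < 1) : 0 < w (sampleArm w u) := by
  classical
  -- The last arm qualifies because `u < 1`, so the default value of `sampleArm` is never used.
  have hne : (Finset.univ.filter fun j : Fin K => u < ∑ l ∈ Finset.Iic j, w l).Nonempty := by
    refine ⟨⊤, ?_⟩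
    simp only [Finset.mem_filter, Finset.mem_univ, true_and, Finset.Iic_top]
    linarith
  have hdef : sampleArm w u = Finset.min' _ hne := by
    unfold sampleArm
    rw [dif_pos]
  set j := sampleArm w u with hj
  have hmem := Finset.min'_mem _ hne
  rw [← hdef] at hmem
  simp only [Finset.mem_filter, Finset.mem_univ, true_and] at hmem
  -- Otherwise arm `j - 1` would already qualify, against minimality. Then `u` lies in an interval
  -- of length `w j`, which is therefore positive.
  have hle : ∑ l ∈ Finset.Iio j, w l ≤ u := by
    by_cases hz : (j : ℕ) = 0
    · have : Finset.Iio j = ∅ := by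
        ext l
        simp [Fin.lt_def, hz]
      simpa [this] using h0
    · by_contra! hlt
      have hlt' : (j : ℕ) - 1 < K := by omega
      let j' : Fin K := ⟨j - 1, hlt'⟩
      have hIic : Finset.Iic j' = Finset.Iio j := by
        ext l
        simp only [Finset.mem_Iic, Finset.mem_Iio, Fin.le_def, Fin.lt_def, j']
        omega
      have := Finset.min'_le (Finset.univ.filter fun j : Fin K => u < ∑ l ∈ Finset.Iic j, w l) j'
        (by simpa [hIic] using hlt)
      rw [← hdef, Fin.le_def] at this
      simp only [j'] at this
      omega
  rw [sum_Iic_eq_sum_Iio_add] at hmem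
  linarith

/-- The arm sampled with a uniform random number is distributed according to the weights. -/
lemma sum_weight_mul_le_lintegral {w : Fin K → ℝ} (hw : ∀ i, 0 ≤ w i) (hsum : ∑ i, w i ≤ 1)
    (φ : Fin K → ENNReal) :
    ∑ j, ENNReal.ofReal (w j) * φ j ≤ ∫⁻ u in Set.Icc (0 : ℝ) 1, φ (sampleArm w u) := by
  let I : Fin K → Set ℝ := fun j => Set.Ico (∑ l ∈ Finset.Iio j, w l) (∑ l ∈ Finset.Iic j, w l)
  have hI : ∀ j, ∀ u ∈ I j, sampleArm w u = j := fun j u hu => sampleArm_eq hw hu.1 hu.2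
  have hsub : (⋃ j ∈ (Finset.univ : Finset (Fin K)), I j) ⊆ Set.Icc (0 : ℝ) 1 := by
    intro u hu
    simp only [Finset.mem_univ, Set.iUnion_true, Set.mem_iUnion] at hu
    obtain ⟨j, h1, h2⟩ := hu
    refine ⟨(Finset.sum_nonneg fun l _ => hw l).trans h1, h2.le.trans (le_trans ?_ hsum)⟩
    exact Finset.sum_le_sum_of_subset_of_nonneg (Finset.subset_univ _) fun l _ _ => hw l
  have hdisj : ((Finset.univ : Finset (Fin K)) : Set (Fin K)).PairwiseDisjoint I := by
    intro i _ j _ hij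
    refine Set.disjoint_left.2 fun u hi hj => hij ?_
    rw [← hI i u hi, ← hI j u hj]
  -- Only a lower bound is needed, so the part of the unit interval outside the cells is dropped.
  refine le_trans (le_of_eq ?_) (lintegral_mono_set hsub)
  rw [lintegral_biUnion_finset hdisj (fun _ _ => measurableSet_Ico)]
  refine Finset.sum_congr rfl fun j _ => ?_
  rw [setLIntegral_congr_fun measurableSet_Ico (g := fun _ => φ j)
    (fun u hu => by simp only [hI j u hu])]
  rw [setLIntegral_const, Real.volume_Ico, sum_Iic_eq_sum_Iio_add, add_sub_cancel_left, mul_comm]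

end Sampling

/-! ### Measurability of choices with countably many values. -/

section DiscreteMeasurability

variable {α β ι : Type*} [MeasurableSpace α] [MeasurableSpace β]

lemma measurable_apply_countable [Countable ι] {f : α → ι} (hf : ∀ i, MeasurableSet {a | f a = i})
    {g : ι → α → β} (hg : ∀ i, Measurable (g i)) : Measurable fun a => g (f a) a := by
  intro s hs
  have : (fun a => g (f a) a) ⁻¹' s = ⋃ i, {a | f a = i} ∩ g i ⁻¹' s := by
    ext a
    simp
  rw [this]
  exact MeasurableSet.iUnion fun i => (hf i).inter (hg i hs)

lemma measurableSet_finset_eq [Fintype ι] {F : α → Finset ι}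
    (hF : ∀ i, MeasurableSet {a | i ∈ F a}) (A : Finset ι) : MeasurableSet {a | F a = A} := by
  have : {a | F a = A} = ⋂ i, {a | i ∈ F a ↔ i ∈ A} := by
    ext a
    simp [Finset.ext_iff]
  rw [this]
  refine MeasurableSet.iInter fun i => ?_
  by_cases hi : i ∈ A
  · simpa [hi] using hF i
  · simp only [hi, iff_false]
    exact (hF i).compl

lemma measurable_sampleArm {K : ℕ} [NeZero K] {w : α → Fin K → ℝ}
    (hw : ∀ i, Measurable fun a => w a i) {u : α → ℝ} (hu : Measurable u) :
    Measurable fun a => sampleArm (w a) (u a) := by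
  classical
  let F : α → Finset (Fin K) := fun a =>
    Finset.univ.filter fun j : Fin K => u a < ∑ l ∈ Finset.Iic j, w a l
  have hF : ∀ i, MeasurableSet {a | i ∈ F a} := fun i => by
    simp only [F, Finset.mem_filter, Finset.mem_univ, true_and]
    exact measurableSet_lt hu (Finset.measurable_sum _ fun l _ => hw l)
  have : (fun a => sampleArm (w a) (u a))
      = fun a => (fun (A : Finset (Fin K)) (_ : α) => if h : A.Nonempty then A.min' h else 0)
        (F a) a := by
    funext a
    unfold sampleArm
    simp only [F]
  rw [this]
  exact measurable_apply_countable (measurableSet_finset_eq hF)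
    (g := fun A _ => if h : A.Nonempty then A.min' h else 0) fun A => measurable_const

end DiscreteMeasurability

/-! ### Elimination of arms under correct confidence intervals. -/

section Elimination

variable {d K T n : ℕ} {δ : ℝ}

lemma kwSurvivors_succ_subset (h : {t : Fin T // (t : ℕ) < n} → Obs d K) (x : Ctx d K) (κ : ℕ) :
    kwSurvivors δ h x (κ + 1) ⊆ kwSurvivors δ h x κ := by
  classical
  exact Finset.filter_subset _ _

lemma mem_kwSurvivors_succ {h : {t : Fin T // (t : ℕ) < n} → Obs d K} {x : Ctx d K} {κ : ℕ}
    {i : Fin K} : i ∈ kwSurvivors δ h x (κ + 1) ↔ i ∈ kwSurvivors δ h x κ ∧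
      ∀ j ∈ kwSurvivors δ h x κ,
        kwReward δ h x κ j - kwWidth δ h x κ j ≤ kwReward δ h x κ i + kwWidth δ h x κ i := by
  classical
  exact Finset.mem_filter

/-- As long as the confidence intervals are correct, the best arm survives. -/
lemma best_mem_kwSurvivors {h : {t : Fin T // (t : ℕ) < n} → Obs d K} {x : Ctx d K}
    {θ : EuclideanSpace ℝ (Fin d)} {k : ℕ}
    (hgood : ∀ κ < k, ∀ i, |kwReward δ h x κ i - inner ℝ (x i) θ| ≤ kwWidth δ h x κ i)
    {j : Fin K} (hj : ∀ i, inner ℝ (x i) θ ≤ inner ℝ (x j) θ) : j ∈ kwSurvivors δ h x k := by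
  induction k with
  | zero => exact Finset.mem_univ _
  | succ k ih =>
    refine mem_kwSurvivors_succ.2 ⟨ih fun κ hκ => hgood κ (hκ.trans k.lt_succ_self),
      fun i _ => ?_⟩
    have h1 := abs_le.1 (hgood k k.lt_succ_self i)
    have h2 := abs_le.1 (hgood k k.lt_succ_self j)
    have := hj i
    linarith [h1.2, h2.1]

/-- As long as the confidence intervals are correct, the gap of a surviving arm is controlled by
the last widths. -/
lemma gap_le_of_mem_kwSurvivors {h : {t : Fin T // (t : ℕ) < n} → Obs d K} {x : Ctx d K}
    {θ : EuclideanSpace ℝ (Fin d)} {k : ℕ}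
    (hgood : ∀ κ < k + 1, ∀ i, |kwReward δ h x κ i - inner ℝ (x i) θ| ≤ kwWidth δ h x κ i)
    {i j : Fin K} (hi : i ∈ kwSurvivors δ h x (k + 1))
    (hj : ∀ i, inner ℝ (x i) θ ≤ inner ℝ (x j) θ) :
    inner ℝ (x j) θ - inner ℝ (x i) θ ≤ 2 * kwWidth δ h x k i + 2 * kwWidth δ h x k j := by
  have hjk : j ∈ kwSurvivors δ h x k :=
    best_mem_kwSurvivors (fun κ hκ => hgood κ (hκ.trans k.lt_succ_self)) hj
  have h0 := (mem_kwSurvivors_succ.1 hi).2 j hjk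
  have h1 := abs_le.1 (hgood k k.lt_succ_self i)
  have h2 := abs_le.1 (hgood k k.lt_succ_self j)
  linarith [h1.2, h2.1]

/-- The arm with the largest upper confidence bound always survives, whether or not the intervals
are correct; hence the design weights sum to one on every sample. -/
lemma kwSurvivors_nonempty (h : {t : Fin T // (t : ℕ) < n} → Obs d K) (x : Ctx d K)
    [NeZero K] (hα : 0 ≤ kwAlpha d K T δ) (k : ℕ) : (kwSurvivors δ h x k).Nonempty := by
  induction k with
  | zero => exact ⟨0, Finset.mem_univ _⟩
  | succ k ih =>
    obtain ⟨i, hi, hmax⟩ := Finset.exists_max_image _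
      (fun i => kwReward δ h x k i + kwWidth δ h x k i) ih
    refine ⟨i, mem_kwSurvivors_succ.2 ⟨hi, fun j hj => le_trans ?_ (hmax j hj)⟩⟩
    have : 0 ≤ kwWidth δ h x k j := mul_nonneg hα (Real.sqrt_nonneg _)
    linarith

/-- Elimination reads a history only through its matrices and vectors `kwInfo`, `kwXi`, so histories
of different lengths can be compared. -/
lemma kwSurvivors_congr {n' : ℕ} {h : {t : Fin T // (t : ℕ) < n} → Obs d K}
    {h' : {t : Fin T // (t : ℕ) < n'} → Obs d K} (x : Ctx d K) {k : ℕ}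
    (hI : ∀ κ < k, kwInfo δ h κ = kwInfo δ h' κ) (hX : ∀ κ < k, kwXi h κ = kwXi h' κ) :
    kwSurvivors δ h x k = kwSurvivors δ h' x k := by
  induction k with
  | zero => rfl
  | succ k ih =>
    have hk := ih (fun κ hκ => hI κ (hκ.trans k.lt_succ_self))
      fun κ hκ => hX κ (hκ.trans k.lt_succ_self)
    ext i
    simp only [mem_kwSurvivors_succ, hk, kwReward, kwWidth, kwTheta, hI k k.lt_succ_self,
      hX k k.lt_succ_self]

end Elimination

/-! ### The run of the algorithm as a function of contexts, randomness and noises. -/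

section Trajectory

variable {d K T : ℕ} [NeZero K]

/-- The contexts, the internal randomness and the noises at all time steps. -/
abbrev Sample (d K T : ℕ) : Type := (Fin T → Ctx d K × ℝ) × (Fin T → ℝ)

variable (G : GDesignRule d K) (δ : ℝ) (θ : EuclideanSpace ℝ (Fin d))

/-- The observations after `k` batches. -/
def obsLog (z : Sample d K T) (k : ℕ) : Fin T → Obs d K :=
  (batchLinUCBKW T δ G).log θ (fun t => (z.1 t).1) (fun t => (z.1 t).2) z.2 k

/-- What the policy of batch `k` can read. -/
def hist (z : Sample d K T) (k : ℕ) : {t : Fin T // (t : ℕ) < kwGrid T k} → Obs d K :=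
  fun s => obsLog G δ θ z k s.1

/-- The arms that survive the elimination before batch `k`. -/
def survivors (z : Sample d K T) (k : ℕ) (x : Ctx d K) : Finset (Fin K) :=
  kwSurvivors δ (hist G δ θ z k) x k

/-- The arm which the policy of batch `k` plays on given contexts and internal randomness. -/
def playArm (z : Sample d K T) (k : ℕ) (p : Ctx d K × ℝ) : Fin K :=
  sampleArm (G.weight p.1 (survivors G δ θ z k p.1)) p.2

/-- The context vector which the policy of batch `k` plays. -/
def playVec (z : Sample d K T) (k : ℕ) (p : Ctx d K × ℝ) : EuclideanSpace ℝ (Fin d) :=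
  p.1 (playArm G δ θ z k p)

/-- The time steps of batch `k`. -/
def batch (T k : ℕ) : Finset (Fin T) :=
  Finset.univ.filter fun t => kwGrid T k ≤ (t : ℕ) ∧ (t : ℕ) < kwGrid T (k + 1)

lemma mem_batch {k : ℕ} {t : Fin T} :
    t ∈ batch T k ↔ kwGrid T k ≤ (t : ℕ) ∧ (t : ℕ) < kwGrid T (k + 1) := by
  simp [batch]

/-- The regularized Gram matrix of batch `k`. -/
def gram (z : Sample d K T) (k : ℕ) : Matrix (Fin d) (Fin d) ℝ :=
  kwLambda d T δ • (1 : Matrix (Fin d) (Fin d) ℝ) +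
    ∑ t ∈ batch T k, outer (playVec G δ θ z k (z.1 t))

/-- The ridge regression estimate from batch `k`. -/
def ridge (z : Sample d K T) (k : ℕ) : EuclideanSpace ℝ (Fin d) :=
  WithLp.toLp 2 ((gram G δ θ z k)⁻¹ *ᵥ (∑ t ∈ batch T k,
    (inner ℝ (playVec G δ θ z k (z.1 t)) θ + z.2 t) • playVec G δ θ z k (z.1 t)).ofLp)

lemma kwGrid_monotone : Monotone (kwGrid T) := by
  rcases Nat.eq_zero_or_pos T with rfl | hT
  · refine monotone_nat_of_le_succ fun i => ?_
    have hM : kwNumBatches 0 = 0 := by simp [kwNumBatches]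
    simp [kwGrid, hM]
  have hT1 : (1 : ℝ) ≤ T := by exact_mod_cast hT
  have hle : ∀ i, (T : ℝ) ^ (1 - (2 : ℝ)⁻¹ ^ i) ≤ T := fun i => by
    conv_rhs => rw [← Real.rpow_one (T : ℝ)]
    refine Real.rpow_le_rpow_of_exponent_le hT1 ?_
    have : (0 : ℝ) ≤ (2 : ℝ)⁻¹ ^ i := by positivity
    linarith
  refine monotone_nat_of_le_succ fun i => ?_
  unfold kwGrid
  by_cases h0 : i = 0
  · simp [h0]
  rw [if_neg h0, if_neg i.succ_ne_zero]
  split_ifs with h1 h2 h2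
  · refine Nat.floor_mono (Real.rpow_le_rpow_of_exponent_le hT1 ?_)
    have : (2 : ℝ)⁻¹ ^ (i + 1) ≤ (2 : ℝ)⁻¹ ^ i :=
      pow_le_pow_of_le_one (by norm_num) (by norm_num) i.le_succ
    linarith
  · exact Nat.floor_le_of_le (hle i)
  · omega
  · exact le_rfl

lemma obsLog_succ_of_lt (z : Sample d K T) {k : ℕ} {t : Fin T} (ht : (t : ℕ) < kwGrid T k) :
    obsLog G δ θ z (k + 1) t = obsLog G δ θ z k t := if_pos ht

lemma obsLog_succ_of_mem_batch (z : Sample d K T) {k : ℕ} {t : Fin T} (ht : t ∈ batch T k) :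
    obsLog G δ θ z (k + 1) t = ((z.1 t).1, playArm G δ θ z k (z.1 t),
      inner ℝ (playVec G δ θ z k (z.1 t)) θ + z.2 t) := by
  rw [mem_batch] at ht
  unfold obsLog
  rw [BatchLearner.log]
  exact (if_neg (not_lt.2 ht.1)).trans (if_pos ht.2)

lemma obsLog_of_lt_of_le (z : Sample d K T) {k j : ℕ} (hkj : k ≤ j) {t : Fin T}
    (ht : (t : ℕ) < kwGrid T k) : obsLog G δ θ z j t = obsLog G δ θ z k t := by
  induction j, hkj using Nat.le_induction with
  | base => rfl
  | succ j hkj ih => rw [obsLog_succ_of_lt G δ θ z (ht.trans_le (kwGrid_monotone hkj)), ih]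

lemma obsLog_of_mem_batch (z : Sample d K T) {k j : ℕ} (hkj : k < j) {t : Fin T}
    (ht : t ∈ batch T k) :
    obsLog G δ θ z j t = ((z.1 t).1, playArm G δ θ z k (z.1 t),
      inner ℝ (playVec G δ θ z k (z.1 t)) θ + z.2 t) := by
  rw [obsLog_of_lt_of_le G δ θ z hkj (mem_batch.1 ht).2, obsLog_succ_of_mem_batch G δ θ z ht]

lemma sum_subtype_batch {M : Type*} [AddCommMonoid M] {n κ : ℕ} (hn : kwGrid T (κ + 1) ≤ n)
    (f : Fin T → M) :
    (∑ t : {t : Fin T // (t : ℕ) < n} with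
      kwGrid T κ ≤ (t.1 : ℕ) ∧ (t.1 : ℕ) < kwGrid T (κ + 1), f t.1) = ∑ t ∈ batch T κ, f t := by
  refine Finset.sum_bij (fun t _ => t.1) (fun t ht => ?_) (fun a _ b _ h => Subtype.ext h)
    (fun t ht => ?_) fun t _ => rfl
  · simpa [mem_batch] using ht
  · exact ⟨⟨t, (mem_batch.1 ht).2.trans_le hn⟩, by simpa [mem_batch] using ht, rfl⟩

lemma kwInfo_hist (z : Sample d K T) {κ k : ℕ} (h : κ < k) :
    kwInfo δ (hist G δ θ z k) κ = gram G δ θ z κ := by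
  unfold kwInfo gram
  congr 1
  have := sum_subtype_batch (T := T) (n := kwGrid T k) (κ := κ) (kwGrid_monotone h)
    (fun t => outer (obsLog G δ θ z k t).played)
  refine this.trans (Finset.sum_congr rfl fun t ht => ?_)
  rw [obsLog_of_mem_batch G δ θ z h ht]
  rfl

lemma kwXi_hist (z : Sample d K T) {κ k : ℕ} (h : κ < k) :
    kwXi (hist G δ θ z k) κ = ∑ t ∈ batch T κ,
      (inner ℝ (playVec G δ θ z κ (z.1 t)) θ + z.2 t) • playVec G δ θ z κ (z.1 t) := by
  have := sum_subtype_batch (T := T) (n := kwGrid T k) (κ := κ) (kwGrid_monotone h)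
    (fun t => (obsLog G δ θ z k t).reward • (obsLog G δ θ z k t).played)
  refine this.trans (Finset.sum_congr rfl fun t ht => ?_)
  rw [obsLog_of_mem_batch G δ θ z h ht]
  rfl

lemma kwTheta_hist (z : Sample d K T) {κ k : ℕ} (h : κ < k) :
    kwTheta δ (hist G δ θ z k) κ = ridge G δ θ z κ := by
  rw [kwTheta, kwInfo_hist G δ θ z h, kwXi_hist G δ θ z h, ridge]

lemma kwSurvivors_hist (z : Sample d K T) {κ k : ℕ} (h : κ ≤ k) (x : Ctx d K) :
    kwSurvivors δ (hist G δ θ z k) x κ = survivors G δ θ z κ x :=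
  kwSurvivors_congr x
    (fun κ' h' => by rw [kwInfo_hist G δ θ z (h'.trans_le h), kwInfo_hist G δ θ z h'])
    (fun κ' h' => by rw [kwXi_hist G δ θ z (h'.trans_le h), kwXi_hist G δ θ z h'])

lemma arm_eq_playArm (z : Sample d K T) {k : ℕ} (hk : k < kwNumBatches T) {t : Fin T}
    (ht : t ∈ batch T k) :
    (batchLinUCBKW T δ G).arm θ (fun t => (z.1 t).1) (fun t => (z.1 t).2) z.2 t
      = playArm G δ θ z k (z.1 t) :=
  congrArg (fun o : Obs d K => o.2.1) (obsLog_of_mem_batch G δ θ z hk ht)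

/-- The history before batch `k` depends only on what happens before time `kwGrid T k`. -/
lemma hist_congr {z z' : Sample d K T} {k : ℕ}
    (h : ∀ s : Fin T, (s : ℕ) < kwGrid T k → z.1 s = z'.1 s ∧ z.2 s = z'.2 s) :
    hist G δ θ z k = hist G δ θ z' k := by
  induction k with
  | zero =>
    funext s
    exact absurd s.2 (by simp [kwGrid])
  | succ k ih =>
    have hk := ih fun s hs => h s (hs.trans_le (kwGrid_monotone k.le_succ))
    funext s
    have hs := h s.1 s.2
    by_cases hlt : (s.1 : ℕ) < kwGrid T k
    · simp only [hist, obsLog_succ_of_lt G δ θ _ hlt]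
      exact congrFun hk ⟨s.1, hlt⟩
    · have hb : s.1 ∈ batch T k := mem_batch.2 ⟨not_lt.1 hlt, s.2⟩
      simp only [hist, obsLog_succ_of_mem_batch G δ θ _ hb, playVec, playArm, survivors, hk,
        hs.1, hs.2]

lemma survivors_congr {z z' : Sample d K T} {k : ℕ}
    (h : ∀ s : Fin T, (s : ℕ) < kwGrid T k → z.1 s = z'.1 s ∧ z.2 s = z'.2 s) :
    survivors G δ θ z k = survivors G δ θ z' k := by
  funext x
  rw [survivors, survivors, hist_congr G δ θ h]

lemma playVec_congr {z z' : Sample d K T} {k : ℕ}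
    (h : ∀ s : Fin T, (s : ℕ) < kwGrid T k → z.1 s = z'.1 s ∧ z.2 s = z'.2 s) :
    playVec G δ θ z k = playVec G δ θ z' k := by
  funext p
  rw [playVec, playVec, playArm, playArm, survivors_congr G δ θ h]

/-- The noises of batch `k` are not constrained: the plays of a batch ignore its rewards.
Conditioning in the confidence bound and exchangeability of the plays both rest on this. -/
lemma gram_congr {z z' : Sample d K T} {k : ℕ}
    (h : ∀ s : Fin T, (s : ℕ) < kwGrid T k → z.1 s = z'.1 s ∧ z.2 s = z'.2 s)
    (h' : ∀ s ∈ batch T k, z.1 s = z'.1 s) :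
    gram G δ θ z k = gram G δ θ z' k := by
  rw [gram, gram, playVec_congr G δ θ h]
  congr 1
  exact Finset.sum_congr rfl fun s hs => by rw [h' s hs]

end Trajectory

/-! ### Measurability of the trajectory. -/

section Measurability

variable {d K T n : ℕ} {α : Type*} [MeasurableSpace α]

lemma measurable_played {o : α → Obs d K} (ho : Measurable o) :
    Measurable fun a => (o a).played := by
  unfold Obs.played
  refine measurable_apply_countable (f := fun a => (o a).2.1) (g := fun i a => (o a).1 i)
    (fun i => ?_) fun i => ?_
  · exact ho.snd.fst (measurableSet_singleton i)
  · exact (measurable_pi_apply i).comp ho.fst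

variable {h : α → {t : Fin T // (t : ℕ) < n} → Obs d K} {x : α → Ctx d K} (δ : ℝ)

lemma measurable_kwInfo_entry (hh : Measurable h) (κ : ℕ) (i j : Fin d) :
    Measurable fun a => kwInfo δ (h a) κ i j := by
  simp only [kwInfo, Matrix.add_apply, Matrix.sum_apply]
  exact measurable_const.add (Finset.measurable_sum _ fun t _ =>
    measurable_outer_entry (measurable_played ((measurable_pi_apply t).comp hh)) i j)

lemma measurable_kwXi (hh : Measurable h) (κ : ℕ) : Measurable fun a => kwXi (h a) κ := by
  unfold kwXi
  exact Finset.measurable_sum _ fun t _ =>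
    ((measurable_pi_apply t).comp hh).snd.snd.smul
      (measurable_played ((measurable_pi_apply t).comp hh))

lemma measurable_kwReward (hh : Measurable h) (hx : Measurable x) (κ : ℕ) (i : Fin K) :
    Measurable fun a => kwReward δ (h a) (x a) κ i := by
  unfold kwReward kwTheta
  refine ((measurable_pi_apply i).comp hx).inner (measurable_euclidean fun j => ?_)
  simp only [mulVec, dotProduct]
  exact Finset.measurable_sum _ fun l _ =>
    (measurable_inv_entry (measurable_kwInfo_entry δ hh κ) j l).mul
      (measurable_coord (measurable_kwXi hh κ) l)

lemma measurable_kwWidth (hh : Measurable h) (hx : Measurable x) (κ : ℕ) (i : Fin K) :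
    Measurable fun a => kwWidth δ (h a) (x a) κ i := by
  unfold kwWidth
  exact measurable_const.mul (measurable_invQuad (measurable_kwInfo_entry δ hh κ)
    ((measurable_pi_apply i).comp hx)).sqrt

lemma measurableSet_mem_kwSurvivors (hh : Measurable h) (hx : Measurable x) (κ : ℕ) (i : Fin K) :
    MeasurableSet {a | i ∈ kwSurvivors δ (h a) (x a) κ} := by
  induction κ generalizing i with
  | zero => simp [kwSurvivors]
  | succ κ ih =>
    simp only [mem_kwSurvivors_succ]
    refine measurableSet_setOfPred.2 ((measurableSet_setOfPred.1 (ih i)).and ?_)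
    refine Measurable.forall fun j => Measurable.imp (measurableSet_setOfPred.1 (ih j)) ?_
    exact measurableSet_setOfPred.1 (measurableSet_le
      ((measurable_kwReward δ hh hx κ j).sub (measurable_kwWidth δ hh hx κ j))
      ((measurable_kwReward δ hh hx κ i).add (measurable_kwWidth δ hh hx κ i)))

lemma measurable_contexts {z : α → Sample d K T} (hz : Measurable z) (t : Fin T) :
    Measurable fun a => (z a).1 t :=
  (measurable_pi_apply t).comp hz.fst

variable [NeZero K] (G : GDesignRule d K) (θ : EuclideanSpace ℝ (Fin d))

lemma measurable_weight_survivors {z : α → Sample d K T} {k : ℕ}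
    (hz : Measurable fun a => hist G δ θ (z a) k) (hx : Measurable x) (i : Fin K) :
    Measurable fun a => G.weight (x a) (survivors G δ θ (z a) k (x a)) i :=
  measurable_apply_countable (g := fun A a => G.weight (x a) A i)
    (measurableSet_finset_eq fun j => measurableSet_mem_kwSurvivors δ hz hx k j)
    fun A => (G.measurable_weight A i).comp hx

lemma measurable_playArm_of_hist {z : α → Sample d K T} {k : ℕ}
    (hz : Measurable fun a => hist G δ θ (z a) k) {p : α → Ctx d K × ℝ} (hp : Measurable p) :
    Measurable fun a => playArm G δ θ (z a) k (p a) :=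
  measurable_sampleArm (fun i => measurable_weight_survivors δ G θ hz hp.fst i) hp.snd

lemma measurable_playVec_of_hist {z : α → Sample d K T} {k : ℕ}
    (hz : Measurable fun a => hist G δ θ (z a) k) {p : α → Ctx d K × ℝ} (hp : Measurable p) :
    Measurable fun a => playVec G δ θ (z a) k (p a) :=
  measurable_apply_countable (g := fun i a => (p a).1 i)
    (fun i => measurable_playArm_of_hist δ G θ hz hp (measurableSet_singleton i))
    fun i => (measurable_pi_apply i).comp hp.fst

lemma measurable_hist (k : ℕ) : Measurable fun z : Sample d K T => hist G δ θ z k := by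
  induction k with
  | zero =>
    refine measurable_pi_lambda _ fun s => ?_
    exact absurd s.2 (by simp [kwGrid])
  | succ k ih =>
    refine measurable_pi_lambda _ fun s => ?_
    by_cases hlt : (s.1 : ℕ) < kwGrid T k
    · simp only [hist, obsLog_succ_of_lt G δ θ _ hlt]
      exact (measurable_pi_apply (⟨s.1, hlt⟩ : {t : Fin T // (t : ℕ) < kwGrid T k})).comp ih
    · have hb : s.1 ∈ batch T k := mem_batch.2 ⟨not_lt.1 hlt, s.2⟩
      simp only [hist, obsLog_succ_of_mem_batch G δ θ _ hb]
      have hp : Measurable fun z : Sample d K T => z.1 s.1 :=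
        (measurable_pi_apply s.1).comp measurable_fst
      refine hp.fst.prodMk ((measurable_playArm_of_hist δ G θ ih hp).prodMk ?_)
      exact ((measurable_playVec_of_hist δ G θ ih hp).inner measurable_const).add
        ((measurable_pi_apply s.1).comp measurable_snd)

variable {z : α → Sample d K T}

lemma measurable_playVec (hz : Measurable z) (k : ℕ) {p : α → Ctx d K × ℝ} (hp : Measurable p) :
    Measurable fun a => playVec G δ θ (z a) k (p a) :=
  measurable_playVec_of_hist δ G θ ((measurable_hist δ G θ k).comp hz) hp

lemma measurable_gram_entry (hz : Measurable z) (k : ℕ) (i j : Fin d) :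
    Measurable fun a => gram G δ θ (z a) k i j := by
  simp only [gram, Matrix.add_apply, Matrix.sum_apply]
  exact measurable_const.add (Finset.measurable_sum _ fun t _ =>
    measurable_outer_entry (measurable_playVec δ G θ hz k (measurable_contexts hz t)) i j)

lemma measurable_ridge (hz : Measurable z) (k : ℕ) : Measurable fun a => ridge G δ θ (z a) k := by
  unfold ridge
  refine measurable_euclidean fun j => ?_
  simp only [mulVec, dotProduct]
  refine Finset.measurable_sum _ fun l _ =>
    (measurable_inv_entry (measurable_gram_entry δ G θ hz k) j l).mul (measurable_coord ?_ l)
  refine Finset.measurable_sum _ fun t _ => ?_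
  have hv := measurable_playVec δ G θ hz k (measurable_contexts hz t)
  exact ((hv.inner measurable_const).add ((measurable_pi_apply t).comp hz.snd)).smul hv

lemma measurable_invQuad_gram (hz : Measurable z) (k : ℕ) {v : α → EuclideanSpace ℝ (Fin d)}
    (hv : Measurable v) :
    Measurable fun a => invQuad (gram G δ θ (z a) k) (v a) :=
  measurable_invQuad (measurable_gram_entry δ G θ hz k) hv

end Measurability

/-! ### Tail bounds for weighted sums of sub-Gaussian noises. -/

section Subgaussian

lemma HasSubgaussianMGF.of_le {Ω : Type*} [MeasurableSpace Ω] {μ : Measure Ω} {X : Ω → ℝ}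
    {c c' : ℝ≥0} (h : HasSubgaussianMGF X c μ) (hc : c ≤ c') : HasSubgaussianMGF X c' μ where
  integrable_exp_mul := h.integrable_exp_mul
  mgf_le t := (h.mgf_le t).trans (Real.exp_le_exp.2 (by
    have : (c : ℝ) ≤ c' := by exact_mod_cast hc
    have := mul_le_mul_of_nonneg_right this (sq_nonneg t)
    linarith))

variable {ι : Type*} [Fintype ι] {ν : ι → Measure ℝ} [∀ i, IsProbabilityMeasure (ν i)]

lemma hasSubgaussianMGF_sum_mul (hν : ∀ i, HasSubgaussianMGF id 1 (ν i)) (a : ι → ℝ) {q : ℝ}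
    (hq : ∑ i, a i ^ 2 ≤ q) :
    HasSubgaussianMGF (fun y : ι → ℝ => ∑ i, a i * y i) q.toNNReal (Measure.pi ν) := by
  have hind : iIndepFun (fun i (y : ι → ℝ) => a i * y i) (Measure.pi ν) :=
    iIndepFun_pi (X := fun i (v : ℝ) => a i * v) fun i => by fun_prop
  have hsub : ∀ i ∈ (Finset.univ : Finset ι), HasSubgaussianMGF (fun y : ι → ℝ => a i * y i)
      (a i ^ 2).toNNReal (Measure.pi ν) := fun i _ => by
    have h := hν i
    rw [← (measurePreserving_eval ν i).map_eq] at h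
    have h1 : HasSubgaussianMGF (fun y : ι → ℝ => y i) 1 (Measure.pi ν) :=
      HasSubgaussianMGF.of_map (X := id) (Y := Function.eval i) (μ := Measure.pi ν)
        (measurable_pi_apply i).aemeasurable h
    refine HasSubgaussianMGF.of_le (h1.const_mul (a i)) ?_
    rw [← NNReal.coe_le_coe, Real.coe_toNNReal _ (sq_nonneg _)]
    exact (mul_one (a i ^ 2)).le
  refine HasSubgaussianMGF.of_le (HasSubgaussianMGF.sum_of_iIndepFun hind hsub) ?_
  rw [← NNReal.coe_le_coe, NNReal.coe_sum, Real.coe_toNNReal _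
    ((Finset.sum_nonneg fun i _ => sq_nonneg (a i)).trans hq)]
  simpa only [Real.coe_toNNReal _ (sq_nonneg _)] using hq

/-- Hoeffding's inequality for a weighted sum of independent sub-Gaussian variables. -/
lemma measure_abs_sum_mul_gt_le (hν : ∀ i, HasSubgaussianMGF id 1 (ν i)) (a : ι → ℝ) {q : ℝ}
    (hq : ∑ i, a i ^ 2 ≤ q) {τ : ℝ} (hτ : 0 ≤ τ) :
    Measure.pi ν {y | τ * √q < |∑ i, a i * y i|} ≤ ENNReal.ofReal (2 * Real.exp (-τ ^ 2 / 2)) := by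
  have hq0 : 0 ≤ q := (Finset.sum_nonneg fun i _ => sq_nonneg (a i)).trans hq
  -- For `q = 0` all coefficients vanish and the event is empty, thanks to the strict inequality in
  -- its definition.
  rcases hq0.eq_or_lt with rfl | hq0
  · have ha : ∀ i, a i = 0 := fun i => by
      have h0 : ∑ i, a i ^ 2 = 0 := le_antisymm hq (Finset.sum_nonneg fun i _ => sq_nonneg (a i))
      have := (Finset.sum_eq_zero_iff_of_nonneg fun i _ => sq_nonneg (a i)).1 h0 i
        (Finset.mem_univ i)
      simpa using this
    simp [ha]
  · have h1 := hasSubgaussianMGF_sum_mul hν a hq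
    have hτq : 0 ≤ τ * √q := mul_nonneg hτ (Real.sqrt_nonneg _)
    have e : -(τ * √q) ^ 2 / (2 * (q.toNNReal : ℝ)) = -τ ^ 2 / 2 := by
      rw [Real.coe_toNNReal _ hq0.le, mul_pow, Real.sq_sqrt hq0.le]
      field_simp
    have h2 := h1.measure_ge_le hτq
    have h3 := h1.neg.measure_ge_le hτq
    rw [e] at h2 h3
    have hsub : {y : ι → ℝ | τ * √q < |∑ i, a i * y i|} ⊆
        {y | τ * √q ≤ ∑ i, a i * y i} ∪ {y | τ * √q ≤ (-fun y : ι → ℝ => ∑ i, a i * y i) y} := by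
      intro y hy
      rcases lt_abs.1 (show τ * √q < |∑ i, a i * y i| from hy) with h | h
      · exact Or.inl h.le
      · exact Or.inr h.le
    rw [← ofReal_measureReal]
    refine ENNReal.ofReal_le_ofReal ((measureReal_mono hsub).trans
      ((measureReal_union_le _ _).trans ?_))
    linarith

end Subgaussian

/-! ### Bias and noise of the ridge regression estimate. -/

section RidgeError

variable {d K T : ℕ} [NeZero K] (G : GDesignRule d K) {δ : ℝ} (θ : EuclideanSpace ℝ (Fin d))

lemma gram_posDef (hl : 0 < kwLambda d T δ) (z : Sample d K T) (k : ℕ) :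
    (gram G δ θ z k).PosDef :=
  smul_one_add_posDef hl (sum_outer_posSemidef' _ _)

/-- The coefficients of the noises in the error of the ridge regression estimate. -/
def noiseCoeff (z : Sample d K T) (k : ℕ) (x : EuclideanSpace ℝ (Fin d)) (s : Fin T) : ℝ :=
  (playVec G δ θ z k (z.1 s)).ofLp ⬝ᵥ (gram G δ θ z k)⁻¹ *ᵥ x.ofLp

lemma dotProduct_gram_mulVec (z : Sample d K T) (k : ℕ) (v w : Fin d → ℝ) :
    v ⬝ᵥ gram G δ θ z k *ᵥ w = kwLambda d T δ * (v ⬝ᵥ w) +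
      ∑ s ∈ batch T k, ((playVec G δ θ z k (z.1 s)).ofLp ⬝ᵥ v) *
        ((playVec G δ θ z k (z.1 s)).ofLp ⬝ᵥ w) := by
  simp [gram, add_mulVec, dotProduct_add, Matrix.sum_mulVec, dotProduct_sum,
    dotProduct_outer_mulVec, smul_mulVec]

/-- With `v = Λ⁻¹x`, the right side is `vᵀΛv`, which is the left side plus `λ (v·v)`. -/
lemma sum_noiseCoeff_sq_le (hl : 0 < kwLambda d T δ) (z : Sample d K T) (k : ℕ)
    (x : EuclideanSpace ℝ (Fin d)) :
    ∑ s ∈ batch T k, noiseCoeff G (δ := δ) θ z k x s ^ 2 ≤ invQuad (gram G δ θ z k) x := by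
  have hN := gram_posDef G θ hl z k
  set v := (gram G δ θ z k)⁻¹ *ᵥ x.ofLp with hv
  have h1 : v ⬝ᵥ gram G δ θ z k *ᵥ v = invQuad (gram G δ θ z k) x := by
    rw [hv, PosDef.mulVec_inv_mulVec hN, dotProduct_comm, invQuad]
  rw [dotProduct_gram_mulVec] at h1
  have h0 : 0 ≤ v ⬝ᵥ v := by simpa using dotProduct_star_self_nonneg v
  simp only [noiseCoeff, ← hv, pow_two]
  nlinarith

/-- Expanding `xᵀθ = (Λ⁻¹x)ᵀΛθ` cancels the signal part of the estimate and leaves the noise and the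
regularization bias. -/
lemma inner_ridge_sub (hl : 0 < kwLambda d T δ) (z : Sample d K T) (k : ℕ)
    (x : EuclideanSpace ℝ (Fin d)) :
    inner ℝ x (ridge G δ θ z k) - inner ℝ x θ =
      ∑ s ∈ batch T k, noiseCoeff G (δ := δ) θ z k x s * z.2 s
        - kwLambda d T δ * (x.ofLp ⬝ᵥ (gram G δ θ z k)⁻¹ *ᵥ θ.ofLp) := by
  have hN := gram_posDef G θ hl z k
  set N := gram G δ θ z k with hNd
  set v := N⁻¹ *ᵥ x.ofLp with hv
  have h1 : ∀ w : Fin d → ℝ, x.ofLp ⬝ᵥ N⁻¹ *ᵥ w = v ⬝ᵥ w := fun w => by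
    rw [PosDef.dotProduct_mulVec_comm hN.inv, dotProduct_comm]
  have h2 : x.ofLp ⬝ᵥ θ.ofLp = v ⬝ᵥ N *ᵥ θ.ofLp := by
    rw [PosDef.dotProduct_mulVec_comm hN, hv, PosDef.mulVec_inv_mulVec hN, dotProduct_comm]
  rw [inner_eq_dotProduct, inner_eq_dotProduct, ridge]
  simp only
  rw [h1, h1, h2, dotProduct_gram_mulVec]
  simp only [WithLp.ofLp_sum, WithLp.ofLp_smul, dotProduct_sum, dotProduct_smul, smul_eq_mul,
    inner_eq_dotProduct, noiseCoeff, ← hNd, ← hv]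
  have : ∀ s ∈ batch T k, ((playVec G δ θ z k (z.1 s)).ofLp ⬝ᵥ θ.ofLp + z.2 s) *
      (v ⬝ᵥ (playVec G δ θ z k (z.1 s)).ofLp)
      = (playVec G δ θ z k (z.1 s)).ofLp ⬝ᵥ v * ((playVec G δ θ z k (z.1 s)).ofLp ⬝ᵥ θ.ofLp)
        + (playVec G δ θ z k (z.1 s)).ofLp ⬝ᵥ v * z.2 s := fun s _ => by
    rw [dotProduct_comm v]; ring
  rw [Finset.sum_congr rfl this, Finset.sum_add_distrib]
  ring

/-- The regularization contributes at most `√λ ‖θ‖` standard deviations to the error. -/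
lemma abs_bias_le (hl : 0 < kwLambda d T δ) (hθ : ‖θ‖ ≤ 1) (z : Sample d K T) (k : ℕ)
    (x : EuclideanSpace ℝ (Fin d)) :
    |kwLambda d T δ * (x.ofLp ⬝ᵥ (gram G δ θ z k)⁻¹ *ᵥ θ.ofLp)|
      ≤ √(kwLambda d T δ) * √(invQuad (gram G δ θ z k) x) := by
  have hN := gram_posDef G θ hl z k
  have hq := invQuad_nonneg hN x
  have h1 := PosDef.sq_dotProduct_le hN x.ofLp ((gram G δ θ z k)⁻¹ *ᵥ θ.ofLp)
  have h2 : invQuad (gram G δ θ z k) θ ≤ 1 / kwLambda d T δ :=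
    (invQuad_smul_one_add_le hl (sum_outer_posSemidef' _ _) θ).trans
      (div_le_div_of_nonneg_right (pow_le_one₀ (norm_nonneg _) hθ) hl.le)
  rw [PosDef.mulVec_inv_mulVec hN, dotProduct_comm _ θ.ofLp] at h1
  change _ ≤ invQuad _ θ * invQuad _ x at h1
  rw [← Real.sqrt_mul hl.le]
  refine Real.abs_le_sqrt ?_
  rw [mul_pow, pow_two (kwLambda d T δ), mul_assoc]
  refine mul_le_mul_of_nonneg_left ?_ hl.le
  calc _ ≤ kwLambda d T δ * (1 / kwLambda d T δ * invQuad (gram G δ θ z k) x) :=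
        mul_le_mul_of_nonneg_left (h1.trans (mul_le_mul_of_nonneg_right h2 hq)) hl.le
    _ = _ := by field_simp

end RidgeError

/-! ### Validity of the confidence intervals. -/

section Confidence

lemma measurable_context_arm {d K T : ℕ} (t : Fin T) (i : Fin K) :
    Measurable fun z : Sample d K T => (z.1 t).1 i :=
  (measurable_pi_apply i).comp (measurable_contexts measurable_id t).fst

variable {d K T : ℕ} [NeZero K] (G : GDesignRule d K) {δ : ℝ} (θ : EuclideanSpace ℝ (Fin d))

/-- The uniform distribution on the unit interval. -/
abbrev unif : Measure ℝ := volume.restrict (Set.Icc (0 : ℝ) 1)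

instance isProbabilityMeasure_unif : IsProbabilityMeasure unif :=
  ⟨by simp [unif]⟩

/-- The joint law of the contexts, the internal randomness and the noises. -/
def sampleLaw (D : Measure (Ctx d K)) (ν : Fin T → Measure ℝ) : Measure (Sample d K T) :=
  (Measure.pi fun _ => D.prod unif).prod (Measure.pi ν)

variable (D : Measure (Ctx d K)) [IsProbabilityMeasure D] (ν : Fin T → Measure ℝ)
  [∀ t, IsProbabilityMeasure (ν t)]

instance isProbabilityMeasure_sampleLaw : IsProbabilityMeasure (sampleLaw D ν) := by
  unfold sampleLaw; infer_instance

/-- The confidence interval of arm `i` at time `t`, computed from batch `k`, is wrong. -/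
def badSet (δ : ℝ) (k : ℕ) (t : Fin T) (i : Fin K) : Set (Sample d K T) :=
  {z | kwAlpha d K T δ * √(invQuad (gram G δ θ z k) ((z.1 t).1 i))
    < |inner ℝ ((z.1 t).1 i) (ridge G δ θ z k) - inner ℝ ((z.1 t).1 i) θ|}

lemma measurableSet_badSet (k : ℕ) (t : Fin T) (i : Fin K) :
    MeasurableSet (badSet G θ δ k t i) := by
  have hx : Measurable fun z : Sample d K T => (z.1 t).1 i := measurable_context_arm t i
  refine measurableSet_lt (measurable_const.mul
    (measurable_invQuad_gram δ G θ measurable_id k hx).sqrt) ?_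
  exact measurable_norm.comp
    ((hx.inner (𝕜 := ℝ) (measurable_ridge δ G θ measurable_id k)).sub
      (hx.inner (𝕜 := ℝ) (measurable_const (a := θ))))

lemma updateFinset_batch_of_lt (e : Fin T → ℝ) (k : ℕ) (y : batch T k → ℝ) {s : Fin T}
    (hs : (s : ℕ) < kwGrid T k) : Function.updateFinset e (batch T k) y s = e s := by
  rw [Function.updateFinset, dif_neg]
  exact fun h => absurd (mem_batch.1 h).1 (not_le.2 hs)

/-- Integrating only over the noises of batch `k`, with everything else frozen, makes the
coefficients deterministic and Hoeffding's inequality applicable. The budget `α` splits into `√λ`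
for the bias and `τ` for the noise. -/
lemma sampleLaw_badSet_le (hl : 0 < kwLambda d T δ) (hθ : ‖θ‖ ≤ 1)
    (hν : ∀ t, HasSubgaussianMGF id 1 (ν t)) {τ : ℝ} (hτ : 0 ≤ τ)
    (hα : τ + √(kwLambda d T δ) ≤ kwAlpha d K T δ) (k : ℕ) (t : Fin T) (i : Fin K) :
    sampleLaw D ν (badSet G θ δ k t i) ≤ ENNReal.ofReal (2 * Real.exp (-τ ^ 2 / 2)) := by
  classical
  set c := ENNReal.ofReal (2 * Real.exp (-τ ^ 2 / 2)) with hc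
  rw [sampleLaw, Measure.prod_apply (measurableSet_badSet G θ k t i)]
  refine (lintegral_mono (g := fun _ => c) fun xu => ?_).trans (by simp)
  set E := Prod.mk xu ⁻¹' badSet G θ δ k t i with hE
  have hEm : MeasurableSet E := measurable_prodMk_left (measurableSet_badSet G θ k t i)
  rw [← lintegral_indicator_one hEm]
  refine (lintegral_le_of_lmarginal_le (μ := ν) (batch T k) (g := fun _ => c)
    (measurable_one.indicator hEm) measurable_const fun e => ?_).trans (by simp)
  have hEy : MeasurableSet {y : batch T k → ℝ | Function.updateFinset e (batch T k) y ∈ E} :=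
    measurable_updateFinset hEm
  have h1 : (∫⋯∫⁻_batch T k, fun _ => c ∂ν) e = c := by simp [lmarginal]
  rw [h1, lmarginal]
  have h2 : ∀ y : batch T k → ℝ, E.indicator (1 : (Fin T → ℝ) → ENNReal)
      (Function.updateFinset e (batch T k) y)
      = {y | Function.updateFinset e (batch T k) y ∈ E}.indicator 1 y := fun y => rfl
  simp_rw [h2]
  rw [lintegral_indicator_one hEy]
  set x := (xu t).1 i with hx
  refine le_trans (measure_mono fun y hy => ?_)
    (measure_abs_sum_mul_gt_le (ν := fun s : batch T k => ν s) (fun s => hν s)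
      (fun s => noiseCoeff G (δ := δ) θ (xu, e) k x s) (q := invQuad (gram G δ θ (xu, e) k) x)
      ?_ hτ)
  · have hcongr : ∀ s : Fin T, (s : ℕ) < kwGrid T k →
        (xu, Function.updateFinset e (batch T k) y).1 s = (xu, e).1 s ∧
        (xu, Function.updateFinset e (batch T k) y).2 s = (xu, e).2 s := fun s hs =>
      ⟨rfl, updateFinset_batch_of_lt e k y hs⟩
    have hg := gram_congr G δ θ (z := (xu, Function.updateFinset e (batch T k) y))
      (z' := (xu, e)) hcongr fun s _ => rfl
    have hp := playVec_congr G δ θ hcongr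
    have hy' : kwAlpha d K T δ * √(invQuad (gram G δ θ (xu, Function.updateFinset e (batch T k) y)
          k) x) < |inner ℝ x (ridge G δ θ (xu, Function.updateFinset e (batch T k) y) k)
            - inner ℝ x θ| := hy
    rw [inner_ridge_sub G θ hl] at hy'
    have hb := abs_bias_le G θ hl hθ (xu, Function.updateFinset e (batch T k) y) k x
    rw [hg] at hy' hb
    have hs : ∑ s ∈ batch T k, noiseCoeff G (δ := δ) θ
          (xu, Function.updateFinset e (batch T k) y) k x s *
          (xu, Function.updateFinset e (batch T k) y).2 s
        = ∑ s : batch T k, noiseCoeff G (δ := δ) θ (xu, e) k x s * y s := by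
      rw [← Finset.sum_coe_sort]
      refine Finset.sum_congr rfl fun s _ => ?_
      simp only [noiseCoeff, hg, hp]
      congr 1
      simp [Function.updateFinset]
    rw [hs] at hy'
    have h3 := abs_sub (∑ s : batch T k, noiseCoeff G (δ := δ) θ (xu, e) k x s * y s)
      (kwLambda d T δ * (x.ofLp ⬝ᵥ (gram G δ θ (xu, e) k)⁻¹ *ᵥ θ.ofLp))
    have h4 := mul_le_mul_of_nonneg_right hα (Real.sqrt_nonneg (invQuad (gram G δ θ (xu, e) k) x))
    rw [add_mul] at h4
    change τ * _ < _
    linarith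
  · have := sum_noiseCoeff_sq_le G θ hl (xu, e) k x
    rwa [← Finset.sum_coe_sort] at this

end Confidence

/-! ### The product law and its invariance under permutation of time steps. -/

section SampleLaw

variable {d K T : ℕ} (D : Measure (Ctx d K)) [IsProbabilityMeasure D] (ν : Fin T → Measure ℝ)
  [∀ t, IsProbabilityMeasure (ν t)]

/-- Permuting the time steps of the contexts and of the internal randomness. -/
def permuteContexts (σ : Equiv.Perm (Fin T)) (z : Sample d K T) : Sample d K T :=
  (fun s => z.1 (σ s), z.2)

/-- Contexts and sampling variables are identically distributed over time. The noises stay in place,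
since their laws may vary with time. -/
lemma measurePreserving_permuteContexts (σ : Equiv.Perm (Fin T)) :
    MeasurePreserving (permuteContexts σ) (sampleLaw D ν) (sampleLaw D ν) := by
  have h := measurePreserving_piCongrLeft (α := fun _ : Fin T => Ctx d K × ℝ)
    (fun _ => D.prod unif) σ.symm
  have h2 : (MeasurableEquiv.piCongrLeft (fun _ : Fin T => Ctx d K × ℝ) σ.symm :
      (Fin T → Ctx d K × ℝ) → Fin T → Ctx d K × ℝ) = fun x s => x (σ s) := by
    funext x s
    have := Equiv.piCongrLeft_apply_apply (P := fun _ : Fin T => Ctx d K × ℝ) σ.symm x (σ s)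
    rw [Equiv.symm_apply_apply] at this
    exact this
  rw [h2] at h
  exact h.prod (MeasurePreserving.id (Measure.pi ν))

lemma ae_norm_context_le (hD : ∀ᵐ x ∂D, ∀ i, ‖x i‖ ≤ 1) :
    ∀ᵐ z ∂sampleLaw D ν, ∀ t i, ‖(z.1 t).1 i‖ ≤ 1 := by
  rw [ae_all_iff]
  intro t
  have h1 : MeasurePreserving (fun z : Sample d K T => (z.1 t).1) (sampleLaw D ν) D :=
    (measurePreserving_fst (μ := D) (ν := unif)).comp
      ((measurePreserving_eval (fun _ : Fin T => D.prod unif) t).comp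
        (measurePreserving_fst (ν := Measure.pi ν)))
  exact h1.quasiMeasurePreserving.ae hD

lemma ae_randomness_mem :
    ∀ᵐ z ∂sampleLaw D ν, ∀ t, 0 ≤ (z.1 t).2 ∧ (z.1 t).2 < 1 := by
  rw [ae_all_iff]
  intro t
  have h1 : MeasurePreserving (fun z : Sample d K T => (z.1 t).2) (sampleLaw D ν) unif :=
    (measurePreserving_snd (μ := D) (ν := unif)).comp
      ((measurePreserving_eval (fun _ : Fin T => D.prod unif) t).comp
        (measurePreserving_fst (ν := Measure.pi ν)))
  refine h1.quasiMeasurePreserving.ae (p := fun u => 0 ≤ u ∧ u < 1) ?_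
  have h2 : ∀ᵐ u ∂unif, u ≠ 1 := Measure.ae_ne _ 1
  filter_upwards [ae_restrict_mem measurableSet_Icc, h2] with u hu hu'
  exact ⟨hu.1, lt_of_le_of_ne hu.2 hu'⟩

end SampleLaw

/-! ### Expected design variance by exchangeability. -/

section LeaveOneOut

variable {d K T : ℕ} [NeZero K] (G : GDesignRule d K) {δ : ℝ} (θ : EuclideanSpace ℝ (Fin d))
  (D : Measure (Ctx d K))

lemma sum_weight_survivors (z : Sample d K T) (k : ℕ) (x : Ctx d K) :
    ∑ i, G.weight x (survivors G δ θ z k x) i = 1 := by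
  rw [← G.sum_eq_one x (survivors G δ θ z k x)
    (kwSurvivors_nonempty _ _ (mul_nonneg (by norm_num) (Real.sqrt_nonneg _)) _)]
  symm
  exact Finset.sum_subset (Finset.subset_univ _) fun i _ hi => G.eq_zero _ _ _ hi

lemma lintegral_sum_weight_le (z : Sample d K T) (k : ℕ) {N : Matrix (Fin d) (Fin d) ℝ}
    (hN : N.PosDef) :
    ∫⁻ p, ENNReal.ofReal (∑ j, G.weight p.1 (survivors G δ θ z k p.1) j * invQuad N (p.1 j))
        ∂D.prod unif ≤
      ∫⁻ p, ENNReal.ofReal (invQuad N (playVec G δ θ z k p)) ∂D.prod unif := by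
  have hz : Measurable fun _ : Ctx d K × ℝ => hist G δ θ z k := measurable_const
  have hj : ∀ j, Measurable fun p : Ctx d K × ℝ => p.1 j := fun j =>
    (measurable_pi_apply j).comp measurable_fst
  have hm3 : Measurable fun p : Ctx d K × ℝ => ENNReal.ofReal (∑ j,
      G.weight p.1 (survivors G δ θ z k p.1) j * invQuad N (p.1 j)) :=
    (Finset.measurable_sum _ fun j _ =>
      (measurable_weight_survivors (x := fun p : Ctx d K × ℝ => p.1) δ G θ hz measurable_fst j).mul
        (measurable_invQuad (M := fun _ => N) (fun _ _ => measurable_const)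
          (hj j))).ennreal_ofReal
  have hm4 : Measurable fun p : Ctx d K × ℝ =>
      ENNReal.ofReal (invQuad N (playVec G δ θ z k p)) :=
    (measurable_invQuad (M := fun _ => N) (fun _ _ => measurable_const)
      (measurable_playVec_of_hist δ G θ hz measurable_id)).ennreal_ofReal
  rw [lintegral_prod _ hm3.aemeasurable, lintegral_prod _ hm4.aemeasurable]
  refine lintegral_mono fun x => ?_
  simp only [lintegral_const, measure_univ, mul_one]
  rw [ENNReal.ofReal_sum_of_nonneg fun j _ => mul_nonneg (G.nonneg _ _ _) (invQuad_nonneg hN _)]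
  simp only [ENNReal.ofReal_mul (G.nonneg _ _ _)]
  exact sum_weight_mul_le_lintegral (G.nonneg _ _) (sum_weight_survivors G θ _ k x).le
    fun j => ENNReal.ofReal (invQuad N (x j))

variable [IsProbabilityMeasure D] (ν : Fin T → Measure ℝ) [∀ t, IsProbabilityMeasure (ν t)]

/-- The variance of the estimate from batch `k`, averaged over the design of batch `k` on the
contexts at time `t`. -/
def designVar (δ : ℝ) (z : Sample d K T) (k : ℕ) (t : Fin T) : ℝ :=
  ∑ j, G.weight (z.1 t).1 (survivors G δ θ z k (z.1 t).1) j *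
    invQuad (gram G δ θ z k) ((z.1 t).1 j)

lemma measurable_designVar (k : ℕ) (t : Fin T) :
    Measurable fun z : Sample d K T => designVar G θ δ z k t := by
  unfold designVar
  exact Finset.measurable_sum _ fun j _ =>
    (measurable_weight_survivors δ G θ (measurable_hist δ G θ k)
      (measurable_contexts measurable_id t).fst j).mul
    (measurable_invQuad_gram δ G θ measurable_id k (measurable_context_arm t j))

lemma designVar_nonneg (hl : 0 < kwLambda d T δ) (z : Sample d K T) (k : ℕ) (t : Fin T) :
    0 ≤ designVar G θ δ z k t :=
  Finset.sum_nonneg fun _ _ => mul_nonneg (G.nonneg _ _ _)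
    (invQuad_nonneg (gram_posDef G θ hl z k) _)

lemma designVar_le_one (hl : 1 ≤ kwLambda d T δ) (z : Sample d K T) (k : ℕ) (t : Fin T)
    (hx : ∀ i, ‖(z.1 t).1 i‖ ≤ 1) : designVar G θ δ z k t ≤ 1 := by
  rw [← sum_weight_survivors G (δ := δ) θ z k (z.1 t).1]
  refine Finset.sum_le_sum fun j _ => mul_le_of_le_one_right (G.nonneg _ _ _) ?_
  refine (invQuad_smul_one_add_le (by linarith) (sum_outer_posSemidef' _ _) _).trans ?_
  rw [div_le_one (by linarith)]
  exact (pow_le_one₀ (norm_nonneg _) (hx j)).trans hl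

/-- Resampling the internal randomness: the average over the design is the expectation over the
played context vector. -/
lemma lintegral_designVar_le (hl : 0 < kwLambda d T δ) {k : ℕ} {t : Fin T}
    (ht : kwGrid T (k + 1) ≤ (t : ℕ)) :
    ∫⁻ z, ENNReal.ofReal (designVar G θ δ z k t) ∂sampleLaw D ν ≤
      ∫⁻ z, ENNReal.ofReal (invQuad (gram G δ θ z k) (playVec G δ θ z k (z.1 t)))
        ∂sampleLaw D ν := by
  have hm1 : Measurable fun z : Sample d K T => ENNReal.ofReal (designVar G θ δ z k t) :=
    (measurable_designVar G θ k t).ennreal_ofReal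
  have hm2 : Measurable fun z : Sample d K T =>
      ENNReal.ofReal (invQuad (gram G δ θ z k) (playVec G δ θ z k (z.1 t))) :=
    (measurable_invQuad_gram δ G θ measurable_id k (measurable_playVec δ G θ measurable_id k
      (measurable_contexts measurable_id t))).ennreal_ofReal
  rw [sampleLaw, lintegral_prod_symm _ hm1.aemeasurable, lintegral_prod_symm _ hm2.aemeasurable]
  refine lintegral_mono fun e => ?_
  refine lintegral_le_of_lmarginal_le (μ := fun _ => D.prod unif) {t}
    (hm1.comp measurable_prodMk_right) (hm2.comp measurable_prodMk_right) fun xu => ?_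
  -- Time `t` lies after batch `k`, so resampling its coordinate leaves the policy and the Gram
  -- matrix of batch `k` unchanged.
  have hne : ∀ s : Fin T, (s : ℕ) < kwGrid T (k + 1) → s ≠ t := by
    rintro s hs rfl
    exact absurd hs (not_lt.2 ht)
  have hcongr : ∀ p, ∀ s : Fin T, (s : ℕ) < kwGrid T k →
      (Function.update xu t p, e).1 s = (xu, e).1 s ∧
      (Function.update xu t p, e).2 s = (xu, e).2 s := fun p s hs =>
    ⟨Function.update_of_ne (hne s (hs.trans_le (kwGrid_monotone k.le_succ))) _ _, rfl⟩
  have hg := fun p => gram_congr G δ θ (z := (Function.update xu t p, e)) (z' := (xu, e))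
    (hcongr p) fun s hs => Function.update_of_ne (hne s (mem_batch.1 hs).2) _ _
  have hp := fun p => playVec_congr G δ θ (hcongr p)
  have hs := fun p => survivors_congr G δ θ (hcongr p)
  rw [lmarginal_singleton, lmarginal_singleton]
  simp only [designVar, hg, hp, hs, Function.update_self]
  exact lintegral_sum_weight_le G θ D (xu, e) k (gram_posDef G θ hl (xu, e) k)

/-- The Gram matrix of batch `k` and of the virtual play of its policy at time `t`. -/
def gramInsert (δ : ℝ) (z : Sample d K T) (k : ℕ) (t : Fin T) : Matrix (Fin d) (Fin d) ℝ :=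
  kwLambda d T δ • (1 : Matrix (Fin d) (Fin d) ℝ) +
    ∑ s ∈ insert t (batch T k), outer (playVec G δ θ z k (z.1 s))

lemma notMem_batch_of_le {k : ℕ} {t : Fin T} (ht : kwGrid T (k + 1) ≤ (t : ℕ)) :
    t ∉ batch T k := fun h => absurd (mem_batch.1 h).2 (not_lt.2 ht)

lemma invQuad_gram_le (hl : 1 ≤ kwLambda d T δ) {k : ℕ} {t : Fin T}
    (ht : kwGrid T (k + 1) ≤ (t : ℕ)) (z : Sample d K T) (hx : ∀ i, ‖(z.1 t).1 i‖ ≤ 1) :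
    invQuad (gram G δ θ z k) (playVec G δ θ z k (z.1 t)) ≤
      2 * invQuad (gramInsert G θ δ z k t) (playVec G δ θ z k (z.1 t)) := by
  rw [gramInsert, Finset.sum_insert (notMem_batch_of_le ht), add_comm (outer _)]
  exact invQuad_le_two_mul_invQuad_add_outer hl (sum_outer_posSemidef' _ _) _ _ (hx _)

lemma sum_invQuad_gramInsert_le (hl : 0 < kwLambda d T δ) (z : Sample d K T) (k : ℕ) (t : Fin T) :
    ∑ s ∈ insert t (batch T k), invQuad (gramInsert G θ δ z k t) (playVec G δ θ z k (z.1 s))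
      ≤ d := by
  have := sum_mul_invQuad_le (insert t (batch T k)) (fun _ => 1) (fun _ _ => zero_le_one)
    (fun s => playVec G δ θ z k (z.1 s)) hl
  simpa [gramInsert] using this

/-- Both swapped times lie at or after the start of batch `k`, so its policy is unchanged, and the
swap merely permutes the summands of the joint Gram matrix. Without inserting `t` this symmetry
would fail. -/
lemma gramInsert_permuteContexts {k : ℕ} {s t : Fin T} (hs : s ∈ batch T k)
    (ht : kwGrid T (k + 1) ≤ (t : ℕ)) (z : Sample d K T) :
    playVec G δ θ (permuteContexts (Equiv.swap s t) z) k = playVec G δ θ z k ∧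
    gramInsert G θ δ (permuteContexts (Equiv.swap s t) z) k t = gramInsert G θ δ z k t := by
  have hp : playVec G δ θ (permuteContexts (Equiv.swap s t) z) k = playVec G δ θ z k := by
    refine playVec_congr G δ θ fun r hr => ⟨?_, rfl⟩
    have h1 : r ≠ s := by
      rintro rfl
      exact absurd (mem_batch.1 hs).1 (not_le.2 hr)
    have h2 : r ≠ t := by
      rintro rfl
      exact absurd hr (not_lt.2 ((kwGrid_monotone k.le_succ).trans ht))
    simp only [permuteContexts, Equiv.swap_apply_of_ne_of_ne h1 h2]
  refine ⟨hp, ?_⟩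
  rw [gramInsert, gramInsert, hp]
  congr 1
  refine Finset.sum_equiv (Equiv.swap s t) (fun r => ?_) fun r _ => rfl
  have hs' : s ∈ insert t (batch T k) := Finset.mem_insert_of_mem hs
  have ht' : t ∈ insert t (batch T k) := Finset.mem_insert_self _ _
  by_cases h1 : r = s
  · subst h1; simp only [Equiv.swap_apply_left, hs', ht']
  by_cases h2 : r = t
  · subst h2; simp only [Equiv.swap_apply_right, hs', ht']
  · rw [Equiv.swap_apply_of_ne_of_ne h1 h2]

lemma measurable_invQuad_gramInsert (k : ℕ) (s t : Fin T) :
    Measurable fun z : Sample d K T =>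
      invQuad (gramInsert G θ δ z k t) (playVec G δ θ z k (z.1 s)) := by
  have hv := fun r : Fin T => measurable_playVec δ G θ (measurable_id (α := Sample d K T)) k
    (measurable_contexts measurable_id r)
  refine measurable_invQuad (fun i j => ?_) (hv s)
  simp only [gramInsert, Matrix.add_apply, Matrix.sum_apply]
  exact measurable_const.add (Finset.measurable_sum _ fun r _ => measurable_outer_entry (hv r) i j)

lemma lintegral_invQuad_gramInsert_eq {k : ℕ} {s t : Fin T} (hs : s ∈ batch T k)
    (ht : kwGrid T (k + 1) ≤ (t : ℕ)) :
    ∫⁻ z, ENNReal.ofReal (invQuad (gramInsert G θ δ z k t) (playVec G δ θ z k (z.1 s)))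
        ∂sampleLaw D ν =
      ∫⁻ z, ENNReal.ofReal (invQuad (gramInsert G θ δ z k t) (playVec G δ θ z k (z.1 t)))
        ∂sampleLaw D ν := by
  rw [← (measurePreserving_permuteContexts D ν (Equiv.swap s t)).lintegral_comp
    (measurable_invQuad_gramInsert G θ k s t).ennreal_ofReal]
  refine lintegral_congr fun z => ?_
  obtain ⟨h1, h2⟩ := gramInsert_permuteContexts G (δ := δ) θ hs ht z
  rw [h1, h2]
  simp only [permuteContexts, Equiv.swap_apply_left]

/-- By exchangeability, the expected design variance of the estimate from a batch of `n` time
steps is at most `2d / (n + 1)`. -/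
lemma mul_lintegral_designVar_le (hl : 1 ≤ kwLambda d T δ) (hD : ∀ᵐ x ∂D, ∀ i, ‖x i‖ ≤ 1)
    {k : ℕ} {t : Fin T} (ht : kwGrid T (k + 1) ≤ (t : ℕ)) :
    ((batch T k).card + 1 : ENNReal) * ∫⁻ z, ENNReal.ofReal (designVar G θ δ z k t) ∂sampleLaw D ν
      ≤ 2 * d := by
  have hl0 : 0 < kwLambda d T δ := by linarith
  have h1 : ∫⁻ z, ENNReal.ofReal (designVar G θ δ z k t) ∂sampleLaw D ν ≤
      2 * ∫⁻ z, ENNReal.ofReal (invQuad (gramInsert G θ δ z k t) (playVec G δ θ z k (z.1 t)))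
        ∂sampleLaw D ν := by
    refine (lintegral_designVar_le G θ D ν hl0 ht).trans ?_
    rw [← lintegral_const_mul _ (measurable_invQuad_gramInsert G θ k t t).ennreal_ofReal]
    refine lintegral_mono_ae ?_
    filter_upwards [ae_norm_context_le D ν hD] with z hz
    rw [← ENNReal.ofReal_ofNat 2, ← ENNReal.ofReal_mul (by norm_num)]
    exact ENNReal.ofReal_le_ofReal (invQuad_gram_le G θ hl ht z (hz t))
  set I := ∫⁻ z, ENNReal.ofReal (invQuad (gramInsert G θ δ z k t) (playVec G δ θ z k (z.1 t)))
        ∂sampleLaw D ν with hI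
  have h2 : ((batch T k).card + 1 : ENNReal) * I ≤ d := by
    have h3 : ∑ s ∈ insert t (batch T k), ∫⁻ z, ENNReal.ofReal
        (invQuad (gramInsert G θ δ z k t) (playVec G δ θ z k (z.1 s))) ∂sampleLaw D ν
        = ((batch T k).card + 1 : ENNReal) * I := by
      rw [Finset.sum_insert (notMem_batch_of_le ht), Finset.sum_congr rfl fun s hs =>
        lintegral_invQuad_gramInsert_eq G θ D ν hs ht]
      simp only [Finset.sum_const, nsmul_eq_mul, ← hI]
      ring
    rw [← h3, ← lintegral_finsetSum _ fun s _ =>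
      (measurable_invQuad_gramInsert G θ k s t).ennreal_ofReal]
    refine (lintegral_mono (g := fun _ => (d : ENNReal)) fun z => ?_).trans (by simp)
    have hpos : (gramInsert G θ δ z k t).PosDef :=
      smul_one_add_posDef hl0 (sum_outer_posSemidef' _ _)
    rw [← ENNReal.ofReal_sum_of_nonneg fun s _ => invQuad_nonneg hpos _,
      ← ENNReal.ofReal_natCast]
    exact ENNReal.ofReal_le_ofReal (sum_invQuad_gramInsert_le G θ hl0 z k t)
  calc _ ≤ ((batch T k).card + 1 : ENNReal) * (2 * I) := by gcongr
    _ = 2 * (((batch T k).card + 1 : ENNReal) * I) := by ring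
    _ ≤ 2 * d := by gcongr

lemma integrable_designVar (hl : 1 ≤ kwLambda d T δ) (hD : ∀ᵐ x ∂D, ∀ i, ‖x i‖ ≤ 1)
    (k : ℕ) (t : Fin T) : Integrable (fun z => designVar G θ δ z k t) (sampleLaw D ν) := by
  refine Integrable.of_bound (measurable_designVar G θ k t).aestronglyMeasurable 1 ?_
  filter_upwards [ae_norm_context_le D ν hD] with z hz
  rw [Real.norm_of_nonneg (designVar_nonneg G θ (by linarith) z k t)]
  exact designVar_le_one G θ hl z k t (hz t)

lemma integral_designVar_le (hl : 1 ≤ kwLambda d T δ) (hD : ∀ᵐ x ∂D, ∀ i, ‖x i‖ ≤ 1)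
    {k : ℕ} {t : Fin T} (ht : kwGrid T (k + 1) ≤ (t : ℕ)) :
    ((batch T k).card + 1 : ℝ) * ∫ z, designVar G θ δ z k t ∂sampleLaw D ν ≤ 2 * d := by
  rw [integral_eq_lintegral_of_nonneg_ae
    (.of_forall fun z => designVar_nonneg G θ (by linarith) z k t)
    (measurable_designVar G θ k t).aestronglyMeasurable]
  have h := ENNReal.toReal_mono (by finiteness) (mul_lintegral_designVar_le G θ D ν hl hD ht)
  rw [ENNReal.toReal_mul, ENNReal.toReal_mul, ENNReal.toReal_add (by finiteness) (by finiteness)]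
    at h
  simpa using h

end LeaveOneOut

/-! ### The grid, its rounding and the lengths of the batches. -/

section Grid

variable {T : ℕ}

/-- The end points of the batches before rounding. -/
def realGrid (T i : ℕ) : ℝ := (T : ℝ) ^ (1 - (2 : ℝ)⁻¹ ^ i)

/-- Here `3 ≥ 2√2` gives `log₂ T ≥ 3/2 ≥ √2`. A positive lower bound for `log log T` is what absorbs
the ceiling in the number of batches and the additive terms of the regret. -/
lemma logb_logb_ge_half (hT : 3 ≤ T) : 1 / 2 ≤ Real.logb 2 (Real.logb 2 T) := by
  have hT' : (3 : ℝ) ≤ T := by exact_mod_cast hT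
  have h1 : (3 / 2 : ℝ) ≤ Real.logb 2 T := by
    rw [Real.le_logb_iff_rpow_le (by norm_num) (by linarith)]
    refine le_trans ?_ hT'
    have h2 : √(2 : ℝ) ≤ 3 / 2 := (Real.sqrt_le_left (by norm_num)).2 (by norm_num)
    rw [show (3 / 2 : ℝ) = 1 + 1 / 2 by norm_num, Real.rpow_add (by norm_num), Real.rpow_one,
      ← Real.sqrt_eq_rpow]
    linarith
  rw [Real.le_logb_iff_rpow_le (by norm_num) (by linarith), ← Real.sqrt_eq_rpow]
  refine le_trans ?_ h1
  rw [Real.sqrt_le_left (by norm_num)]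
  norm_num

lemma kwNumBatches_pos (hT : 3 ≤ T) : 0 < kwNumBatches T :=
  Nat.ceil_pos.2 (by linarith [logb_logb_ge_half hT])

lemma kwNumBatches_le (hT : 3 ≤ T) :
    (kwNumBatches T : ℝ) ≤ 3 * Real.logb 2 (Real.logb 2 T) := by
  have h := logb_logb_ge_half hT
  have := Nat.ceil_lt_add_one (a := Real.logb 2 (Real.logb 2 T)) (by linarith)
  unfold kwNumBatches
  linarith

lemma rpow_inv_two_pow_eq (hT : 3 ≤ T) (i : ℕ) :
    (T : ℝ) ^ ((2 : ℝ)⁻¹ ^ i) = 2 ^ (Real.logb 2 T / 2 ^ i) := by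
  have hT0 : (0 : ℝ) < T := by exact_mod_cast (by omega : 0 < T)
  conv_lhs => rw [← Real.rpow_logb (b := 2) (by norm_num) (by norm_num) hT0]
  rw [← Real.rpow_mul (by norm_num), inv_pow, div_eq_mul_inv]

lemma logb_pos_of_three_le (hT : 3 ≤ T) : 0 < Real.logb 2 T :=
  Real.logb_pos (by norm_num) (by exact_mod_cast (by omega : 1 < T))

lemma two_lt_rpow_inv_two_pow (hT : 3 ≤ T) {i : ℕ} (hi : i < kwNumBatches T) :
    2 < (T : ℝ) ^ ((2 : ℝ)⁻¹ ^ i) := by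
  have h1 := Nat.lt_ceil.1 hi
  rw [Real.lt_logb_iff_rpow_lt (by norm_num) (logb_pos_of_three_le hT), Real.rpow_natCast] at h1
  rw [rpow_inv_two_pow_eq hT]
  conv_lhs => rw [← Real.rpow_one 2]
  refine Real.rpow_lt_rpow_of_exponent_lt (by norm_num) ?_
  rwa [one_lt_div (by positivity)]

lemma rpow_inv_two_pow_numBatches_le (hT : 3 ≤ T) :
    (T : ℝ) ^ ((2 : ℝ)⁻¹ ^ kwNumBatches T) ≤ 2 := by
  have h1 : Real.logb 2 (Real.logb 2 T) ≤ kwNumBatches T := Nat.le_ceil _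
  rw [Real.logb_le_iff_le_rpow (by norm_num) (logb_pos_of_three_le hT), Real.rpow_natCast] at h1
  rw [rpow_inv_two_pow_eq hT]
  conv_rhs => rw [← Real.rpow_one 2]
  refine Real.rpow_le_rpow_of_exponent_le (by norm_num) ?_
  rwa [div_le_one (by positivity)]

lemma realGrid_mul (hT : 3 ≤ T) (i : ℕ) : realGrid T i * (T : ℝ) ^ ((2 : ℝ)⁻¹ ^ i) = T := by
  have hT0 : (0 : ℝ) < T := by exact_mod_cast (by omega : 0 < T)
  rw [realGrid, ← Real.rpow_add hT0, sub_add_cancel, Real.rpow_one]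

lemma realGrid_succ (hT : 3 ≤ T) (i : ℕ) :
    realGrid T (i + 1) = realGrid T i * (T : ℝ) ^ ((2 : ℝ)⁻¹ ^ (i + 1)) := by
  have hT0 : (0 : ℝ) < T := by exact_mod_cast (by omega : 0 < T)
  rw [realGrid, realGrid, ← Real.rpow_add hT0]
  congr 1
  rw [pow_succ]
  ring

/-- The recursion behind the choice of exponents: it balances the length of a batch against the
accuracy gained from the previous one. -/
lemma realGrid_succ_eq_sqrt (T i : ℕ) (hT : 3 ≤ T) :
    realGrid T (i + 1) = √T * √(realGrid T i) := by
  have hT0 : (0 : ℝ) < T := by exact_mod_cast (by omega : 0 < T)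
  rw [Real.sqrt_eq_rpow, Real.sqrt_eq_rpow, realGrid, realGrid, ← Real.rpow_mul hT0.le,
    ← Real.rpow_add hT0]
  congr 1
  rw [pow_succ]
  ring

lemma one_le_realGrid (hT : 3 ≤ T) (i : ℕ) : 1 ≤ realGrid T i :=
  Real.one_le_rpow (by exact_mod_cast (by omega : 1 ≤ T))
    (sub_nonneg.2 (pow_le_one₀ (by norm_num) (by norm_num)))

lemma two_mul_realGrid_le (hT : 3 ≤ T) {i : ℕ} (hi : i + 1 < kwNumBatches T) :
    2 * realGrid T i ≤ realGrid T (i + 1) := by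
  rw [realGrid_succ hT, mul_comm]
  exact mul_le_mul_of_nonneg_left (two_lt_rpow_inv_two_pow hT hi).le
    (by linarith [one_le_realGrid hT i])

lemma kwGrid_zero : kwGrid T 0 = 0 := by simp [kwGrid]

lemma kwGrid_of_lt {i : ℕ} (h0 : i ≠ 0) (hi : i < kwNumBatches T) :
    kwGrid T i = ⌊realGrid T i⌋₊ := by
  rw [kwGrid, if_neg h0, if_pos hi, realGrid]

lemma kwGrid_numBatches (hT : 3 ≤ T) : kwGrid T (kwNumBatches T) = T := by
  rw [kwGrid, if_neg (kwNumBatches_pos hT).ne', if_neg (lt_irrefl _)]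

lemma kwGrid_le (hT : 3 ≤ T) {i : ℕ} (hi : i ≤ kwNumBatches T) : kwGrid T i ≤ T :=
  (kwGrid_monotone hi).trans (kwGrid_numBatches hT).le

/-- The factor `2` is for the last end point, which is raised to `T`; the number of batches is large
enough that `T ^ (2⁻ᴹ) ≤ 2`. -/
lemma kwGrid_le_two_mul_realGrid (hT : 3 ≤ T) {i : ℕ} (hi : i ≤ kwNumBatches T) :
    (kwGrid T i : ℝ) ≤ 2 * realGrid T i := by
  have h1 := one_le_realGrid hT i
  rcases hi.eq_or_lt with rfl | hi
  · rw [kwGrid_numBatches hT]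
    conv_lhs => rw [← realGrid_mul hT (kwNumBatches T), mul_comm]
    exact mul_le_mul_of_nonneg_right (rpow_inv_two_pow_numBatches_le hT) (by linarith)
  · by_cases h0 : i = 0
    · subst h0
      rw [kwGrid_zero, Nat.cast_zero]
      linarith
    · rw [kwGrid_of_lt h0 hi]
      have := Nat.floor_le (a := realGrid T i) (by linarith)
      linarith

lemma realGrid_div_four_le (hT : 3 ≤ T) {i : ℕ} (hi : i + 1 < kwNumBatches T) :
    realGrid T (i + 1) / 4 ≤ (kwGrid T (i + 1) : ℝ) - kwGrid T i := by
  have hb := one_le_realGrid hT (i + 1)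
  have ha := one_le_realGrid hT i
  have h2 := two_mul_realGrid_le hT hi
  have hfl := Nat.lt_floor_add_one (realGrid T (i + 1))
  rw [kwGrid_of_lt i.succ_ne_zero hi]
  by_cases h0 : i = 0
  · subst h0
    rw [kwGrid_zero, Nat.cast_zero]
    have : 1 ≤ ⌊realGrid T (0 + 1)⌋₊ := Nat.le_floor (by simpa using hb)
    have : (1 : ℝ) ≤ ⌊realGrid T (0 + 1)⌋₊ := by exact_mod_cast this
    linarith
  · rw [kwGrid_of_lt h0 (by omega)]
    have hfa := Nat.floor_le (a := realGrid T i) (by linarith)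
    have h3 : ⌊realGrid T i⌋₊ + 1 ≤ ⌊realGrid T (i + 1)⌋₊ := by
      rw [← Nat.floor_add_one (by linarith)]
      exact Nat.floor_mono (by linarith)
    have h3' : (⌊realGrid T i⌋₊ : ℝ) + 1 ≤ ⌊realGrid T (i + 1)⌋₊ := by exact_mod_cast h3
    -- With `b` the new and `a ≤ b/2` the old unrounded end point, the difference of the floors
    -- exceeds `b/2 - 1 ≥ b/4` for `b ≥ 4`; for smaller `b` it is at least `1 > b/4`.
    by_cases h4 : 4 ≤ realGrid T (i + 1)
    · linarith
    · linarith

lemma kwGrid_lt_succ (hT : 3 ≤ T) {i : ℕ} (hi : i < kwNumBatches T) :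
    kwGrid T i < kwGrid T (i + 1) := by
  rcases (Nat.succ_le_of_lt hi).eq_or_lt with h | h
  · rw [← Nat.succ_eq_add_one, h, kwGrid_numBatches hT]
    by_cases h0 : i = 0
    · subst h0
      rw [kwGrid_zero]
      omega
    · rw [kwGrid_of_lt h0 hi]
      have h1 := one_le_realGrid hT i
      have h2 := Nat.floor_le (a := realGrid T i) (by linarith)
      have h3 := realGrid_mul hT i
      have h4 := two_lt_rpow_inv_two_pow hT hi
      have : (⌊realGrid T i⌋₊ : ℝ) < T := by nlinarith
      exact_mod_cast this
  · have h1 := realGrid_div_four_le hT h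
    have h2 := one_le_realGrid hT (i + 1)
    have : (kwGrid T i : ℝ) < kwGrid T (i + 1) := by linarith
    exact_mod_cast this

lemma strictMonoOn_kwGrid (hT : 3 ≤ T) : StrictMonoOn (kwGrid T) (Set.Iic (kwNumBatches T)) := by
  refine strictMonoOn_of_lt_add_one Set.ordConnected_Iic fun i _ _ hi => ?_
  exact kwGrid_lt_succ hT (Nat.lt_of_succ_le hi)

lemma le_kwGrid (hT : 3 ≤ T) {i : ℕ} (hi : i ≤ kwNumBatches T) : i ≤ kwGrid T i := by
  induction i with
  | zero => exact Nat.zero_le _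
  | succ i ih => exact (ih (by omega)).trans_lt (kwGrid_lt_succ hT hi)

lemma kwNumBatches_le_horizon (hT : 3 ≤ T) : kwNumBatches T ≤ T :=
  (le_kwGrid hT le_rfl).trans (kwGrid_numBatches hT).le

lemma card_batch (hT : 3 ≤ T) {k : ℕ} (hk : k < kwNumBatches T) :
    (batch T k).card = kwGrid T (k + 1) - kwGrid T k := by
  have h : (batch T k).map Fin.valEmbedding = Finset.Ico (kwGrid T k) (kwGrid T (k + 1)) := by
    ext n
    simp only [Finset.mem_map, mem_batch, Fin.valEmbedding_apply, Finset.mem_Ico]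
    exact ⟨by rintro ⟨t, ht, rfl⟩; exact ht,
      fun hn => ⟨⟨n, hn.2.trans_le (kwGrid_le hT hk)⟩, hn, rfl⟩⟩
  rw [← Finset.card_map, h, Nat.card_Ico]

lemma sum_eq_sum_batch (hT : 3 ≤ T) (f : Fin T → ℝ) :
    ∑ t, f t = ∑ k ∈ Finset.range (kwNumBatches T), ∑ t ∈ batch T k, f t := by
  have h : ∀ k, ∑ t ∈ Finset.univ.filter (fun t : Fin T => (t : ℕ) < kwGrid T k), f t
      = ∑ j ∈ Finset.range k, ∑ t ∈ batch T j, f t := fun k => by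
    induction k with
    | zero => simp [kwGrid_zero]
    | succ k ih =>
      rw [Finset.sum_range_succ, ← ih, ← Finset.sum_union]
      · refine Finset.sum_congr ?_ fun _ _ => rfl
        ext t
        have : kwGrid T k ≤ kwGrid T (k + 1) := kwGrid_monotone k.le_succ
        simp only [Finset.mem_filter, Finset.mem_univ, true_and, Finset.mem_union, mem_batch]
        omega
      · refine Finset.disjoint_left.2 fun t ht ht' => ?_
        simp only [Finset.mem_filter, Finset.mem_univ, true_and] at ht
        exact absurd (mem_batch.1 ht').1 (not_le.2 ht)
  rw [← h, kwGrid_numBatches hT]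
  refine Finset.sum_congr ?_ fun _ _ => rfl
  ext t
  simp

/-- The length of a batch is at most `4 √T` times the square root of the length of the previous
batch. -/
lemma card_batch_succ_div_sqrt_le (hT : 3 ≤ T) {k : ℕ} (hk : k + 1 < kwNumBatches T) :
    ((batch T (k + 1)).card : ℝ) / √((batch T k).card) ≤ 4 * √T := by
  -- The batch is no longer than its end point, at most `2√T√b` with `b = realGrid T (k + 1)`, while
  -- the previous batch has length at least `b/4`; the quotient is `2 / (1/2) = 4` times `√T`.
  have h1 : ((batch T (k + 1)).card : ℝ) ≤ 2 * (√T * √(realGrid T (k + 1))) := by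
    rw [← realGrid_succ_eq_sqrt T _ hT]
    refine le_trans ?_ (kwGrid_le_two_mul_realGrid hT hk)
    rw [card_batch hT hk]
    exact_mod_cast Nat.sub_le _ _
  have h2 : realGrid T (k + 1) / 4 ≤ ((batch T k).card : ℝ) := by
    rw [card_batch hT (by omega), Nat.cast_sub (kwGrid_monotone k.le_succ)]
    exact realGrid_div_four_le hT hk
  have h3 : √(realGrid T (k + 1)) / 2 ≤ √((batch T k).card) := by
    have : √(realGrid T (k + 1) / 4) = √(realGrid T (k + 1)) / 2 := by
      rw [Real.sqrt_div' _ (by norm_num)]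
      congr 1
      rw [show (4 : ℝ) = 2 ^ 2 by norm_num, Real.sqrt_sq (by norm_num)]
    rw [← this]
    exact Real.sqrt_le_sqrt h2
  have h4 := one_le_realGrid hT (k + 1)
  have h5 : 0 < √(realGrid T (k + 1)) := Real.sqrt_pos.2 (by linarith)
  rw [div_le_iff₀ (by linarith)]
  have := mul_le_mul_of_nonneg_left h3 (Real.sqrt_nonneg (T : ℝ))
  linarith

lemma card_batch_zero_le (hT : 3 ≤ T) : ((batch T 0).card : ℝ) ≤ 2 * √T := by
  have h1 : ((batch T 0).card : ℝ) ≤ kwGrid T 1 := by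
    rw [card_batch hT (kwNumBatches_pos hT)]
    exact_mod_cast Nat.sub_le _ _
  have h2 := kwGrid_le_two_mul_realGrid hT (i := 1) (kwNumBatches_pos hT)
  have h3 : realGrid T 1 = √T := by
    rw [realGrid_succ_eq_sqrt T 0 hT]
    simp [realGrid]
  rw [h3] at h2
  exact h1.trans h2

end Grid

/-! ### Numerical constants. -/

section Constants

variable {d K T : ℕ} [NeZero d] [NeZero K] {δ : ℝ}

lemma one_le_cast_of_neZero (n : ℕ) [NeZero n] : (1 : ℝ) ≤ n := by
  exact_mod_cast NeZero.one_le

lemma three_le_mul_div (hT : 3 ≤ T) (hδ : 0 < δ) (hδ' : δ < 1) : 3 ≤ (d * K * T / δ : ℝ) := by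
  have hd := one_le_cast_of_neZero d
  have hK := one_le_cast_of_neZero K
  have hT' : (3 : ℝ) ≤ T := by exact_mod_cast hT
  rw [le_div_iff₀ hδ]
  have h1 : (1 : ℝ) ≤ d * K := one_le_mul_of_one_le_of_one_le hd hK
  nlinarith

lemma one_le_kwLambda (hT : 3 ≤ T) (hδ : 0 < δ) (hδ' : δ < 1) : 1 ≤ kwLambda d T δ := by
  have h := three_le_mul_div (d := d) (K := 1) hT hδ hδ'
  rw [Nat.cast_one, mul_one] at h
  have h1 : 1 ≤ Real.log (2 * d * T / δ) := by
    rw [Real.le_log_iff_exp_le]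
    · have := Real.exp_one_lt_three
      have e : (2 * d * T / δ : ℝ) = 2 * (d * T / δ) := by ring
      linarith
    · have e : (2 * d * T / δ : ℝ) = 2 * (d * T / δ) := by ring
      linarith
  unfold kwLambda
  linarith

/-- The constant `10` of `kwAlpha` is `6` for the noise plus `4 = √16` for the bias. -/
lemma add_sqrt_kwLambda_le (hT : 3 ≤ T) (hδ : 0 < δ) (hδ' : δ < 1) :
    6 * √(Real.log (2 * d * K * T / δ)) + √(kwLambda d T δ) ≤ kwAlpha d K T δ := by
  have h := three_le_mul_div (d := d) (K := 1) hT hδ hδ'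
  rw [Nat.cast_one, mul_one] at h
  have hK := one_le_cast_of_neZero K
  have e : (2 * d * T / δ : ℝ) = 2 * (d * T / δ) := by ring
  have h1 : √(kwLambda d T δ) = 4 * √(Real.log (2 * d * T / δ)) := by
    rw [kwLambda, Real.sqrt_mul (by norm_num), show (16 : ℝ) = 4 ^ 2 by norm_num,
      Real.sqrt_sq (by norm_num)]
  have h2 : Real.log (2 * d * T / δ) ≤ Real.log (2 * d * K * T / δ) := by
    refine Real.log_le_log (by linarith) ?_
    have e' : (2 * d * K * T / δ : ℝ) = 2 * (d * T / δ) * K := by ring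
    rw [e, e']
    exact le_mul_of_one_le_right (by linarith) hK
  have h3 := Real.sqrt_le_sqrt h2
  rw [h1, kwAlpha]
  linarith

/-- With `Y = 2dKT/δ` the exponential is `Y⁻¹⁸ ≤ Y⁻²`, and `Y ≥ 2KT`. The prefactor collects `T`
times, at most `T` batches, `K` arms, a two-sided tail and a gap of at most `2`. -/
lemma failure_prob_le (hT : 3 ≤ T) (hδ : 0 < δ) (hδ' : δ < 1) :
    4 * (T : ℝ) ^ 2 * K * Real.exp (-(6 * √(Real.log (2 * d * K * T / δ))) ^ 2 / 2) ≤ 1 := by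
  have h := three_le_mul_div (d := d) (K := K) hT hδ hδ'
  have hd := one_le_cast_of_neZero d
  have hK := one_le_cast_of_neZero K
  have hT' : (3 : ℝ) ≤ T := by exact_mod_cast hT
  set Y : ℝ := 2 * d * K * T / δ with hY
  have hY2 : 2 * (K * T) ≤ Y := by
    rw [hY, le_div_iff₀ hδ]
    have h1 : (0 : ℝ) < K * T := by positivity
    calc 2 * (K * T : ℝ) * δ ≤ 2 * (K * T) * 1 := by gcongr
      _ ≤ 2 * (K * T) * d := by gcongr
      _ = 2 * d * K * T := by ring
  have hY0 : 0 < Y := by nlinarith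
  have hY1 : 1 ≤ Y := by nlinarith
  have hlog : 0 ≤ Real.log Y := Real.log_nonneg hY1
  rw [mul_pow, Real.sq_sqrt hlog]
  have h1 : Real.exp (-(6 ^ 2 * Real.log Y) / 2) ≤ (Y ^ 2)⁻¹ := by
    rw [← Real.exp_log (inv_pos.2 (pow_pos hY0 2)), Real.log_inv, Real.log_pow]
    refine Real.exp_le_exp.2 ?_
    push_cast
    linarith
  have h2 : 4 * (T : ℝ) ^ 2 * K ≤ Y ^ 2 := by
    calc 4 * (T : ℝ) ^ 2 * K ≤ 4 * (T : ℝ) ^ 2 * K * K :=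
          le_mul_of_one_le_right (by positivity) hK
      _ = (2 * (K * T)) ^ 2 := by ring
      _ ≤ Y ^ 2 := pow_le_pow_left₀ (by positivity) hY2 2
  calc _ ≤ Y ^ 2 * (Y ^ 2)⁻¹ := mul_le_mul h2 h1 (Real.exp_nonneg _) (by positivity)
    _ = 1 := mul_inv_cancel₀ (by positivity)

lemma kwAlpha_le (hT : 3 ≤ T) (hδ : 0 < δ) (hδ' : δ < 1) :
    kwAlpha d K T δ ≤ 15 * √(Real.logb 2 (d * K * T / δ)) := by
  have h := three_le_mul_div (d := d) (K := K) hT hδ hδ'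
  set X : ℝ := d * K * T / δ with hX
  have e : (2 * d * K * T / δ : ℝ) = 2 * X := by rw [hX]; ring
  have hlog2 : 0 < Real.log 2 := Real.log_pos (by norm_num)
  have h1 : Real.log (2 * X) ≤ 2 * Real.logb 2 X := by
    rw [Real.log_mul (by norm_num) (by linarith)]
    have h2 : Real.log 2 ≤ Real.log X := Real.log_le_log (by norm_num) (by linarith)
    have h3 : Real.log X ≤ Real.logb 2 X := by
      rw [Real.logb, le_div_iff₀ hlog2]
      have := Real.log_two_lt_d9
      nlinarith
    linarith
  rw [kwAlpha, e]
  have h4 : √(Real.log (2 * X)) ≤ 3 / 2 * √(Real.logb 2 X) := by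
    refine (Real.sqrt_le_sqrt h1).trans ?_
    rw [Real.sqrt_mul (by norm_num)]
    refine mul_le_mul_of_nonneg_right ?_ (Real.sqrt_nonneg _)
    rw [Real.sqrt_le_left (by norm_num)]
    norm_num
  linarith

/-- The main term gives `3 · 32 · 15 = 1440`, and `4√T + 1 ≤ 5√T` adds at most `10`. -/
lemma regret_constant_le (hT : 3 ≤ T) (hδ : 0 < δ) (hδ' : δ < 1) :
    4 * √T + 1 + kwNumBatches T * (32 * kwAlpha d K T δ * d * √T) ≤
      2000 * (d * √(T * Real.logb 2 (d * K * T / δ)) * Real.logb 2 (Real.logb 2 T)) := by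
  have h := three_le_mul_div (d := d) (K := K) hT hδ hδ'
  have hd := one_le_cast_of_neZero d
  have hT' : (3 : ℝ) ≤ T := by exact_mod_cast hT
  have hα := kwAlpha_le (d := d) (K := K) hT hδ hδ'
  have hM := kwNumBatches_le hT
  have hLL := logb_logb_ge_half hT
  set X : ℝ := d * K * T / δ
  have hX : 1 ≤ Real.logb 2 X := by
    rw [Real.le_logb_iff_rpow_le (by norm_num) (by linarith), Real.rpow_one]
    linarith
  rw [Real.sqrt_mul (by linarith)]
  set s := √(Real.logb 2 X)
  set LL := Real.logb 2 (Real.logb 2 T)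
  have hs : 1 ≤ s := Real.one_le_sqrt.2 hX
  have hsT : 1 ≤ √(T : ℝ) := Real.one_le_sqrt.2 (by linarith)
  have hα0 : 0 ≤ kwAlpha d K T δ := mul_nonneg (by norm_num) (Real.sqrt_nonneg _)
  have h1 : kwNumBatches T * (32 * kwAlpha d K T δ * d * √T) ≤
      3 * LL * (32 * (15 * s) * d * √T) := by gcongr
  have h2 : √(T : ℝ) ≤ 2 * (d * (√T * s) * LL) := by
    calc √(T : ℝ) = 2 * (1 * (√T * 1) * (1 / 2)) := by ring
      _ ≤ 2 * (d * (√T * s) * LL) := by gcongr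
  have h3 : 3 * LL * (32 * (15 * s) * d * √T) = 1440 * (d * (√T * s) * LL) := by ring
  nlinarith

end Constants

/-! ### From widths to regret. -/

section Regret

variable {d K T : ℕ} [NeZero K] (G : GDesignRule d K) (δ : ℝ) (θ : EuclideanSpace ℝ (Fin d))

/-- The regret incurred at time `t`. -/
def gap (z : Sample d K T) (t : Fin T) : ℝ :=
  (⨆ i : Fin K, inner ℝ ((z.1 t).1 i) θ) - inner ℝ ((z.1 t).1
    ((batchLinUCBKW T δ G).arm θ (fun t => (z.1 t).1) (fun t => (z.1 t).2) z.2 t)) θ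

lemma gap_nonneg (z : Sample d K T) (t : Fin T) : 0 ≤ gap G δ θ z t :=
  sub_nonneg.2 (le_ciSup (f := fun i => inner ℝ ((z.1 t).1 i) θ) (Set.finite_range _).bddAbove _)

lemma gap_le_two (hθ : ‖θ‖ ≤ 1) (z : Sample d K T) (t : Fin T)
    (hx : ∀ i, ‖(z.1 t).1 i‖ ≤ 1) : gap G δ θ z t ≤ 2 := by
  have h : ∀ i, |inner ℝ ((z.1 t).1 i) θ| ≤ 1 := fun i =>
    (abs_real_inner_le_norm _ _).trans (mul_le_one₀ (hx i) (norm_nonneg _) hθ)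
  have h1 : (⨆ i : Fin K, inner ℝ ((z.1 t).1 i) θ) ≤ 1 := ciSup_le fun i => (abs_le.1 (h i)).2
  have h2 := (abs_le.1 (h ((batchLinUCBKW T δ G).arm θ (fun t => (z.1 t).1)
    (fun t => (z.1 t).2) z.2 t))).1
  unfold gap
  linarith

lemma measurable_arm (hT : 3 ≤ T) (t : Fin T) : Measurable fun z : Sample d K T =>
    (batchLinUCBKW T δ G).arm θ (fun t => (z.1 t).1) (fun t => (z.1 t).2) z.2 t := by
  have ht : (t : ℕ) < kwGrid T (kwNumBatches T) := by
    rw [kwGrid_numBatches hT]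
    exact t.2
  exact ((measurable_pi_apply (⟨t, ht⟩ : {t : Fin T // (t : ℕ) < kwGrid T (kwNumBatches T)})).comp
    (measurable_hist δ G θ (kwNumBatches T))).snd.fst

lemma measurable_gap (hT : 3 ≤ T) (t : Fin T) :
    Measurable fun z : Sample d K T => gap G δ θ z t := by
  unfold gap
  refine Measurable.sub (Measurable.iSup fun i =>
    (measurable_context_arm t i).inner measurable_const) ?_
  refine Measurable.inner ?_ measurable_const
  exact measurable_apply_countable (g := fun i (z : Sample d K T) => (z.1 t).1 i)
    (fun i => measurable_arm G δ θ hT t (measurableSet_singleton i))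
    fun i => measurable_context_arm t i

variable {δ}

/-- When all confidence intervals are correct, the regret is controlled by the design variance of
the last estimate. -/
lemma gap_le_of_notMem_badSet (hl : 0 < kwLambda d T δ) {k : ℕ} (hk : k + 1 < kwNumBatches T)
    {t : Fin T} (ht : t ∈ batch T (k + 1)) (z : Sample d K T)
    (hu : 0 ≤ (z.1 t).2 ∧ (z.1 t).2 < 1)
    (hgood : ∀ κ < k + 1, ∀ i, z ∉ badSet G θ δ κ t i) :
    gap G δ θ z t ≤ 4 * kwAlpha d K T δ * √(2 * d * designVar G θ δ z k t) := by
  have hα : 0 ≤ kwAlpha d K T δ := mul_nonneg (by norm_num) (Real.sqrt_nonneg _)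
  set x := (z.1 t).1 with hx
  set h := hist G δ θ z (k + 1) with hh
  have hgood' : ∀ κ < k + 1, ∀ i, |kwReward δ h x κ i - inner ℝ (x i) θ| ≤ kwWidth δ h x κ i := by
    intro κ hκ i
    have := hgood κ hκ i
    rw [badSet, Set.mem_ofPred_eq, not_lt] at this
    rwa [kwReward, kwWidth, hh, kwTheta_hist G δ θ z hκ, kwInfo_hist G δ θ z hκ]
  -- Index `k` is deliberate: these are the arms before the last elimination, on which the design of
  -- batch `k` is defined. Both the played arm and the best arm belong to them.
  have hwidth : ∀ i ∈ kwSurvivors δ h x k,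
      kwWidth δ h x k i ≤ kwAlpha d K T δ * √(2 * d * designVar G θ δ z k t) := by
    intro i hi
    rw [kwWidth, hh, kwInfo_hist G δ θ z k.lt_succ_self]
    refine mul_le_mul_of_nonneg_left (Real.sqrt_le_sqrt ?_) hα
    rw [hh, kwSurvivors_hist G δ θ z k.le_succ] at hi
    exact invQuad_le_sum_weight G x (gram_posDef G θ hl z k) hi
  obtain ⟨j, hj⟩ := Finite.exists_max (fun i : Fin K => (inner ℝ (x i) θ : ℝ))
  have hsup : (⨆ i : Fin K, inner ℝ (x i) θ) = inner ℝ (x j) θ :=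
    le_antisymm (ciSup_le hj) (le_ciSup (f := fun i => inner ℝ (x i) θ)
      (Set.finite_range _).bddAbove j)
  have harm := arm_eq_playArm G δ θ z hk ht
  set i := playArm G δ θ z (k + 1) (z.1 t) with hi
  -- An arm drawn with `u` in `[0, 1)` has positive weight, hence lies in the support of the design.
  have hmem : i ∈ kwSurvivors δ h x (k + 1) := by
    by_contra hcon
    have h0 := G.eq_zero x _ i hcon
    have h1 := sampleArm_weight_pos (sum_weight_survivors G (δ := δ) θ z (k + 1) x).ge hu.1 hu.2
    exact absurd h0 h1.ne'
  have hjk : j ∈ kwSurvivors δ h x k :=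
    best_mem_kwSurvivors (fun κ hκ => hgood' κ (hκ.trans k.lt_succ_self)) hj
  have hgap := gap_le_of_mem_kwSurvivors hgood' hmem hj
  have hwi := hwidth i (kwSurvivors_succ_subset h x k hmem)
  have hwj := hwidth j hjk
  rw [gap, harm, ← hx, hsup]
  linarith

/-- Linearizing the square root by the arithmetic-geometric mean inequality replaces Jensen's
inequality when taking expectations. -/
lemma sqrt_le_half_div_add {s b : ℝ} (hs : 0 ≤ s) (hb : 0 < b) : √s ≤ (s / b + b) / 2 := by
  have h1 := two_mul_le_add_sq (√s) b
  rw [Real.sq_sqrt hs] at h1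
  rw [le_div_iff₀ (by norm_num), ← mul_le_mul_iff_left₀ hb, add_mul, div_mul_cancel₀ _ hb.ne']
  linarith

variable (D : Measure (Ctx d K)) [IsProbabilityMeasure D] (ν : Fin T → Measure ℝ)
  [∀ t, IsProbabilityMeasure (ν t)]

lemma integrable_gap (hT : 3 ≤ T) (hθ : ‖θ‖ ≤ 1) (hD : ∀ᵐ x ∂D, ∀ i, ‖x i‖ ≤ 1) (t : Fin T) :
    Integrable (fun z => gap G δ θ z t) (sampleLaw D ν) := by
  refine Integrable.of_bound (measurable_gap G δ θ hT t).aestronglyMeasurable 2 ?_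
  filter_upwards [ae_norm_context_le D ν hD] with z hz
  rw [Real.norm_of_nonneg (gap_nonneg G δ θ z t)]
  exact gap_le_two G δ θ hθ z t (hz t)

lemma integral_gap_le_two (hT : 3 ≤ T) (hθ : ‖θ‖ ≤ 1) (hD : ∀ᵐ x ∂D, ∀ i, ‖x i‖ ≤ 1)
    (t : Fin T) : ∫ z, gap G δ θ z t ∂sampleLaw D ν ≤ 2 := by
  refine (integral_mono_ae (integrable_gap G θ D ν hT hθ hD t) (integrable_const 2) ?_).trans
    (by simp)
  filter_upwards [ae_norm_context_le D ν hD] with z hz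
  exact gap_le_two G δ θ hθ z t (hz t)

/-- The expected regret at a time step after the first batch. -/
lemma integral_gap_le [NeZero d] (hT : 3 ≤ T) (hδ : 0 < δ) (hδ' : δ < 1) (hθ : ‖θ‖ ≤ 1)
    (hD : ∀ᵐ x ∂D, ∀ i, ‖x i‖ ≤ 1) (hν : ∀ t, HasSubgaussianMGF id 1 (ν t)) {k : ℕ}
    (hk : k + 1 < kwNumBatches T) {t : Fin T} (ht : t ∈ batch T (k + 1)) :
    ∫ z, gap G δ θ z t ∂sampleLaw D ν ≤
      4 * T * K * Real.exp (-(6 * √(Real.log (2 * d * K * T / δ))) ^ 2 / 2) +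
        8 * kwAlpha d K T δ * d / √((batch T k).card) := by
  set μ := sampleLaw D ν with hμ
  set p := Real.exp (-(6 * √(Real.log (2 * d * K * T / δ))) ^ 2 / 2) with hp
  set n : ℝ := ((batch T k).card : ℝ) with hn
  have hl := one_le_kwLambda (d := d) hT hδ hδ'
  have hl0 : 0 < kwLambda d T δ := by linarith
  have hα : 0 ≤ kwAlpha d K T δ := mul_nonneg (by norm_num) (Real.sqrt_nonneg _)
  have hd := one_le_cast_of_neZero d
  have hn0 : 0 < n := by
    have := kwGrid_lt_succ hT (i := k) (by omega)
    rw [hn, card_batch hT (by omega)]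
    exact_mod_cast Nat.sub_pos_of_lt this
  have hsn : 0 < √n := Real.sqrt_pos.2 hn0
  -- The balancing value: `b² = 4d²/n` is the bound on the expectation of `2d` times the design
  -- variance.
  set b : ℝ := 2 * d / √n with hb
  have hb0 : 0 < b := by positivity
  have hbad : ∀ κ i, Integrable ((badSet G θ δ κ t i).indicator (1 : Sample d K T → ℝ)) μ :=
    fun κ i => (integrable_const (1 : ℝ)).indicator (measurableSet_badSet G θ κ t i)
  have hVint := integrable_designVar G θ D ν hl hD k t
  -- The union bound is built in pointwise: if some interval is wrong, one indicator equals `1` and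
  -- pays for the trivial gap bound `2`.
  have hle : ∀ᵐ z ∂μ, gap G δ θ z t ≤
      2 * ∑ κ ∈ Finset.range (k + 1), ∑ i, (badSet G θ δ κ t i).indicator 1 z +
        2 * kwAlpha d K T δ * (2 * d / b * designVar G θ δ z k t + b) := by
    filter_upwards [ae_norm_context_le D ν hD, ae_randomness_mem D ν] with z hz hu
    have hV := designVar_nonneg G θ hl0 z k t
    have hind : ∀ κ i, 0 ≤ (badSet G θ δ κ t i).indicator (1 : Sample d K T → ℝ) z :=
      fun κ i => Set.indicator_nonneg (fun _ _ => zero_le_one) z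
    by_cases hgood : ∀ κ < k + 1, ∀ i, z ∉ badSet G θ δ κ t i
    · have h1 := gap_le_of_notMem_badSet G θ hl0 hk ht z (hu t) hgood
      have h2 := sqrt_le_half_div_add (s := 2 * d * designVar G θ δ z k t) (by positivity) hb0
      have h3 := mul_le_mul_of_nonneg_left h2 (mul_nonneg (by norm_num : (0 : ℝ) ≤ 4) hα)
      have h4 : 0 ≤ ∑ κ ∈ Finset.range (k + 1), ∑ i,
          (badSet G θ δ κ t i).indicator (1 : Sample d K T → ℝ) z :=
        Finset.sum_nonneg fun κ _ => Finset.sum_nonneg fun i _ => hind κ i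
      have e : 4 * kwAlpha d K T δ * ((2 * d * designVar G θ δ z k t / b + b) / 2) =
          2 * kwAlpha d K T δ * (2 * d / b * designVar G θ δ z k t + b) := by ring
      linarith
    · push Not at hgood
      obtain ⟨κ, hκ, i, hi⟩ := hgood
      have h1 := gap_le_two G δ θ hθ z t (hz t)
      have h2 : 1 ≤ ∑ κ ∈ Finset.range (k + 1), ∑ i,
          (badSet G θ δ κ t i).indicator (1 : Sample d K T → ℝ) z := by
        calc (1 : ℝ) = (badSet G θ δ κ t i).indicator (1 : Sample d K T → ℝ) z := by
              rw [Set.indicator_of_mem hi, Pi.one_apply]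
          _ ≤ ∑ i, (badSet G θ δ κ t i).indicator (1 : Sample d K T → ℝ) z :=
              Finset.single_le_sum (fun i _ => hind κ i) (Finset.mem_univ i)
          _ ≤ _ := Finset.single_le_sum
              (f := fun κ => ∑ i, (badSet G θ δ κ t i).indicator (1 : Sample d K T → ℝ) z)
              (fun κ _ => Finset.sum_nonneg fun i _ => hind κ i) (Finset.mem_range.2 hκ)
      have h3 : 0 ≤ 2 * kwAlpha d K T δ * (2 * d / b * designVar G θ δ z k t + b) := by positivity
      linarith
  have hint1 : Integrable (fun z => 2 * ∑ κ ∈ Finset.range (k + 1), ∑ i,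
      (badSet G θ δ κ t i).indicator (1 : Sample d K T → ℝ) z) μ :=
    (integrable_finsetSum _ fun κ _ => integrable_finsetSum _ fun i _ => hbad κ i).const_mul 2
  have hint2 : Integrable (fun z => 2 * kwAlpha d K T δ *
      (2 * d / b * designVar G θ δ z k t + b)) μ :=
    ((hVint.const_mul _).add (integrable_const b)).const_mul _
  have hI := integral_mono_ae (integrable_gap G θ D ν hT hθ hD t) (hint1.add hint2) hle
  refine hI.trans ?_
  simp only [Pi.add_apply]
  rw [integral_add hint1 hint2, integral_const_mul, integral_const_mul,
    integral_add (hVint.const_mul _) (integrable_const b), integral_const_mul,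
    integral_finsetSum _ fun κ _ => integrable_finsetSum _ fun i _ => hbad κ i]
  have hprob : ∀ κ < k + 1, ∀ i, ∫ z, (badSet G θ δ κ t i).indicator (1 : Sample d K T → ℝ) z ∂μ
      ≤ 2 * p := by
    intro κ hκ i
    rw [integral_indicator_one (measurableSet_badSet G θ κ t i)]
    refine ENNReal.toReal_le_of_le_ofReal (by positivity) ?_
    exact sampleLaw_badSet_le G θ D ν hl0 hθ hν (by positivity)
      (add_sqrt_kwLambda_le hT hδ hδ') κ t i
  have hS : ∑ κ ∈ Finset.range (k + 1), ∫ z, ∑ i,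
      (badSet G θ δ κ t i).indicator (1 : Sample d K T → ℝ) z ∂μ ≤ T * (K * (2 * p)) := by
    calc _ ≤ ∑ κ ∈ Finset.range (k + 1), (K * (2 * p) : ℝ) := by
          refine Finset.sum_le_sum fun κ hκ => ?_
          rw [integral_finsetSum _ fun i _ => hbad κ i]
          refine (Finset.sum_le_sum fun i _ => hprob κ (Finset.mem_range.1 hκ) i).trans ?_
          simp
      _ = ((k + 1 : ℕ) : ℝ) * (K * (2 * p)) := by simp
      _ ≤ T * (K * (2 * p)) := by
          refine mul_le_mul_of_nonneg_right ?_ (by positivity)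
          exact_mod_cast hk.le.trans (kwNumBatches_le_horizon hT)
  have hV : ∫ z, designVar G θ δ z k t ∂μ ≤ 2 * d / n := by
    have h1 := integral_designVar_le G θ D ν hl hD (mem_batch.1 ht).1
    have h2 : 0 ≤ ∫ z, designVar G θ δ z k t ∂μ :=
      integral_nonneg fun z => designVar_nonneg G θ hl0 z k t
    rw [le_div_iff₀ hn0]
    linarith
  have hVb : 2 * d / b * ∫ z, designVar G θ δ z k t ∂μ ≤ b := by
    refine (mul_le_mul_of_nonneg_left hV (by positivity)).trans (le_of_eq ?_)
    rw [hb]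
    have hsq : √n * √n = n := Real.mul_self_sqrt hn0.le
    field_simp
    linarith [hsq, Real.sq_sqrt hn0.le]
  have hc : ∫ _, b ∂μ = b := by simp
  rw [hc]
  have h5 := mul_le_mul_of_nonneg_left (add_le_add_left hVb b)
    (mul_nonneg (by norm_num : (0 : ℝ) ≤ 2) hα)
  have e : 2 * kwAlpha d K T δ * (b + b) = 8 * kwAlpha d K T δ * d / √n := by
    rw [hb]; ring
  linarith

/-- The expected regret on the canonical probability space. -/
lemma integral_regret_le [NeZero d] (hT : 3 ≤ T) (hδ : 0 < δ) (hδ' : δ < 1) (hθ : ‖θ‖ ≤ 1)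
    (hD : ∀ᵐ x ∂D, ∀ i, ‖x i‖ ≤ 1) (hν : ∀ t, HasSubgaussianMGF id 1 (ν t)) :
    ∫ z, ∑ t, gap G δ θ z t ∂sampleLaw D ν ≤
      4 * √T + 1 + kwNumBatches T * (32 * kwAlpha d K T δ * d * √T) := by
  have hα : 0 ≤ kwAlpha d K T δ := mul_nonneg (by norm_num) (Real.sqrt_nonneg _)
  set p := Real.exp (-(6 * √(Real.log (2 * d * K * T / δ))) ^ 2 / 2) with hp
  rw [integral_finsetSum _ fun t _ => integrable_gap G θ D ν hT hθ hD t, sum_eq_sum_batch hT]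
  obtain ⟨M, hM⟩ := Nat.exists_eq_add_one_of_ne_zero (kwNumBatches_pos hT).ne'
  -- Batch `0` has no estimate to rely on; it is split off and paid for by its length of at most
  -- `2√T`.
  rw [hM, Finset.sum_range_succ', add_comm]
  have h0 : ∑ t ∈ batch T 0, ∫ z, gap G δ θ z t ∂sampleLaw D ν ≤ 4 * √T := by
    refine (Finset.sum_le_card_nsmul _ _ 2 fun t _ =>
      integral_gap_le_two G θ D ν hT hθ hD t).trans ?_
    rw [nsmul_eq_mul]
    linarith [card_batch_zero_le hT]
  have hk : ∀ k ∈ Finset.range M, ∑ t ∈ batch T (k + 1), ∫ z, gap G δ θ z t ∂sampleLaw D ν ≤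
      (batch T (k + 1)).card * (4 * T * K * p) + 32 * kwAlpha d K T δ * d * √T := by
    intro k hk
    have hk' : k + 1 < kwNumBatches T := by
      rw [hM]
      exact Nat.succ_lt_succ (Finset.mem_range.1 hk)
    refine (Finset.sum_le_card_nsmul _ _ _ fun t ht =>
      integral_gap_le G θ D ν hT hδ hδ' hθ hD hν hk' ht).trans ?_
    rw [nsmul_eq_mul, mul_add]
    have h1 := card_batch_succ_div_sqrt_le hT hk'
    have h2 := mul_le_mul_of_nonneg_left h1
      (by positivity : 0 ≤ 8 * kwAlpha d K T δ * d)
    have e : ((batch T (k + 1)).card : ℝ) * (8 * kwAlpha d K T δ * d / √((batch T k).card)) =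
        8 * kwAlpha d K T δ * d * ((batch T (k + 1)).card / √((batch T k).card)) := by ring
    rw [e]
    linarith
  have hcard : ∑ k ∈ Finset.range M, ((batch T (k + 1)).card : ℝ) ≤ T := by
    have h1 := sum_eq_sum_batch hT fun _ => 1
    rw [hM, Finset.sum_range_succ'] at h1
    simp only [Finset.sum_const, nsmul_eq_mul, mul_one, Finset.card_univ, Fintype.card_fin] at h1
    have : (0 : ℝ) ≤ (batch T 0).card := Nat.cast_nonneg _
    linarith
  have hfail := failure_prob_le (d := d) (K := K) hT hδ hδ'
  rw [← hp] at hfail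
  have hsum := Finset.sum_le_sum hk
  rw [Finset.sum_add_distrib, ← Finset.sum_mul] at hsum
  simp only [Finset.sum_const, nsmul_eq_mul, Finset.card_range] at hsum
  have h1 : (∑ k ∈ Finset.range M, ((batch T (k + 1)).card : ℝ)) * (4 * T * K * p) ≤ 1 := by
    refine (mul_le_mul_of_nonneg_right hcard (by positivity)).trans (le_trans (le_of_eq ?_) hfail)
    ring
  have h2 : (M : ℝ) * (32 * kwAlpha d K T δ * d * √T)
      ≤ ((M + 1 : ℕ) : ℝ) * (32 * kwAlpha d K T δ * d * √T) := by
    refine mul_le_mul_of_nonneg_right ?_ (by positivity)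
    exact_mod_cast M.le_succ
  linarith

end Regret

/-! ### Transfer to an arbitrary probability space. -/

section Transfer

/-- Restricting a nonnegative variable to an event only lowers its expectation, so the confidence
level enters the final bound only through the tuning of the algorithm. -/
lemma highProbExpectedRegret_le_integral {Ω : Type*} [MeasurableSpace Ω]
    {P : Measure Ω} {R : Ω → ℝ} (hR : 0 ≤ R) (hint : Integrable R P)
    (δ : ℝ) : highProbExpectedRegret P δ R ≤ ((∫ ω, R ω ∂P : ℝ) : EReal) := by
  refine iSup_le fun A => iSup_le fun _ => iSup_le fun _ => ?_
  exact EReal.coe_le_coe_iff.2 (setIntegral_le_integral hint (.of_forall hR))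

variable {d K T : ℕ} {Ω : Type*} [MeasurableSpace Ω] {P : Measure Ω} [IsProbabilityMeasure P]
  {D : Measure (Ctx d K)} [IsProbabilityMeasure D] {ν : Fin T → Measure ℝ}
  [∀ t, IsProbabilityMeasure (ν t)] {X : Fin T → Ω → Ctx d K} {U ε : Fin T → Ω → ℝ}

/-- The law of the random elements of a stochastic bandit. -/
lemma IsStochasticBandit.measurePreserving (h : IsStochasticBandit P D ν X U ε) :
    MeasurePreserving (fun ω => ((fun t => (X t ω, U t ω), fun t => ε t ω) : Sample d K T))
      P (sampleLaw D ν) := by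
  have hassoc : ∀ t, P.map (fun ω => ((X t ω, U t ω), ε t ω)) = (D.prod unif).prod (ν t) := by
    intro t
    have h1 : (fun ω => ((X t ω, U t ω), ε t ω)) =
        MeasurableEquiv.prodAssoc.symm ∘ fun ω => (X t ω, U t ω, ε t ω) := rfl
    have h2 : Measurable fun ω => (X t ω, U t ω, ε t ω) :=
      (h.measurable_X t).prodMk ((h.measurable_U t).prodMk (h.measurable_ε t))
    rw [h1, ← Measure.map_map MeasurableEquiv.prodAssoc.symm.measurable h2, h.law t]
    rw [← Measure.prodAssoc_prod, MeasurableEquiv.map_symm_map]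
  have hm : ∀ t, Measurable fun ω => ((X t ω, U t ω), ε t ω) := fun t =>
    ((h.measurable_X t).prodMk (h.measurable_U t)).prodMk (h.measurable_ε t)
  have hind : iIndepFun (fun t ω => ((X t ω, U t ω), ε t ω)) P :=
    h.indep.comp (fun _ => MeasurableEquiv.prodAssoc.symm)
      fun _ => MeasurableEquiv.prodAssoc.symm.measurable
  have hlaw : MeasurePreserving (fun ω t => ((X t ω, U t ω), ε t ω)) P
      (Measure.pi fun t => (D.prod unif).prod (ν t)) := by
    refine ⟨measurable_pi_lambda _ hm, ?_⟩
    rw [(iIndepFun_iff_map_fun_eq_pi_map fun t => (hm t).aemeasurable).1 hind]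
    simp only [hassoc]
  exact (measurePreserving_arrowProdEquivProdArrow (Ctx d K × ℝ) ℝ (Fin T)
    (fun _ => D.prod unif) ν).comp hlaw

end Transfer

end BatchLinBandit

end

theorem mainTheorem7 :
    ∃ C : ℝ, 0 < C ∧
      ∀ (d K T : ℕ) [NeZero d] [NeZero K] (_hT : 3 ≤ T) (δ : ℝ) (_hδ : 0 < δ) (_hδ' : δ < 1),
        Nonempty (BatchLinBandit.GDesignRule d K) ∧
        ∀ G : BatchLinBandit.GDesignRule d K,
          (BatchLinBandit.batchLinUCBKW T δ G).IsGrid ∧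
          ((BatchLinBandit.batchLinUCBKW T δ G).numBatches : ℝ)
            ≤ C * Real.logb 2 (Real.logb 2 T) ∧
          ∀ (Ω : Type*) [MeasurableSpace Ω] (P : Measure Ω) [IsProbabilityMeasure P]
            (D : Measure (BatchLinBandit.Ctx d K)) [IsProbabilityMeasure D]
            (ν : Fin T → Measure ℝ) [∀ t, IsProbabilityMeasure (ν t)]
            (X : Fin T → Ω → BatchLinBandit.Ctx d K) (U ε : Fin T → Ω → ℝ)
            (θ : EuclideanSpace ℝ (Fin d)) (_hθ : ‖θ‖ ≤ 1)
            (_hB : BatchLinBandit.IsStochasticBandit P D ν X U ε),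
            Integrable (fun ω => (BatchLinBandit.batchLinUCBKW T δ G).regret θ
              (fun t => X t ω) (fun t => U t ω) (fun t => ε t ω)) P ∧
            BatchLinBandit.highProbExpectedRegret P δ
              (fun ω => (BatchLinBandit.batchLinUCBKW T δ G).regret θ
                (fun t => X t ω) (fun t => U t ω) (fun t => ε t ω))
              ≤ ((C * (d * √(T * Real.logb 2 (d * K * T / δ)) *
                  Real.logb 2 (Real.logb 2 T)) : ℝ) : EReal) := by
  refine ⟨2000, by norm_num, fun d K T _ _ hT δ hδ hδ' =>
    ⟨BatchLinBandit.nonempty_gDesignRule, fun G => ⟨⟨BatchLinBandit.kwGrid_zero (T := T),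
      BatchLinBandit.kwGrid_numBatches hT, BatchLinBandit.strictMonoOn_kwGrid hT⟩, ?_, ?_⟩⟩⟩
  · have h1 := BatchLinBandit.kwNumBatches_le hT
    have h2 := BatchLinBandit.logb_logb_ge_half hT
    change (BatchLinBandit.kwNumBatches T : ℝ) ≤ _
    linarith
  · intro Ω _ P _ D _ ν _ X U ε θ hθ hB
    have hmp := hB.measurePreserving
    have hZ : Integrable (fun z => ∑ t, BatchLinBandit.gap G δ θ z t)
        (BatchLinBandit.sampleLaw D ν) :=
      integrable_finsetSum _ fun t _ =>
        BatchLinBandit.integrable_gap G θ D ν hT hθ hB.norm_le t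
    -- The regret is by definition the sum of the gaps at the sample point, so integrability and
    -- expectation pull back along the measure-preserving map.
    have hint := hmp.integrable_comp_of_integrable hZ
    refine ⟨hint, (BatchLinBandit.highProbExpectedRegret_le_integral
      (fun ω => Finset.sum_nonneg fun t _ => BatchLinBandit.gap_nonneg G δ θ _ t) hint δ).trans
      (EReal.coe_le_coe_iff.2 ?_)⟩
    have hI := integral_map hmp.measurable.aemeasurable
      (f := fun z => ∑ t, BatchLinBandit.gap G δ θ z t)
      (by rw [hmp.map_eq]; exact hZ.aestronglyMeasurable)
    rw [hmp.map_eq] at hI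
    exact (hI.symm.le.trans (BatchLinBandit.integral_regret_le G θ D ν hT hδ hδ' hθ hB.norm_le
      hB.subgaussian)).trans (BatchLinBandit.regret_constant_le hT hδ hδ')
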